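/- Fix $d\in\mathbb N$ and write $[d]=\{1,\dots,d\}$. **The Butcher–Connes–Kreimer Hopf algebra.** Let $\mathcal T$ be the set of finite non-planar rooted trees with vertices decorated by $[d]$, and $\mathcal F$ the set of forests (finite multisets of trees, $\mathbf 1$ being the empty forest). For $\alpha\in[d]$ let $\mathcal B_+^\alpha$ send a forest to the tree obtained by joining all its roots to a new root decorated by $\alpha$. $\mathcal H_{BCK}$ is the real span of $\mathcal F$ with the forest product $\odot$ and the multiplicative coproduct $\Delta_{BCK}$ determined by $\Delta_{BCK}\mathcal B_+^\alpha=(\mathrm{id}\otimes\mathcal B_+^\alpha)\Delta_{BCK}+\mathcal B_+^\alpha\otimes\mathbf 1$. Its graded dual $\mathcal H_{BCK}^*$ is identified with the span of $\mathcal F$ through $\langle \mathfrak f_1,\mathfrak f_2\rangle=\delta_{\mathfrak f_1\mathfrak f_2}S(\mathfrak f_2)$, where the symmetry factor is $S(\mathfrak f)=S(\mathcal B_+^\alpha(\mathfrak f))=\prod_j r_j!\,S(\tau_j)^{r_j}$ if the distinct trees $\tau_j$ occur in $\mathfrak f$ with multiplicities $r_j$. It carries the unshuffle coproduct $\Delta_{\mathrm{sh}}$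 (multiplicative for $\odot$, trees being primitive) and the Grossman–Larson product $\mathfrak f_1\star_{BCK}\mathfrak f_2=\sum \mathfrak f_1'\odot(\mathfrak f_1''\,\bar\star\,\mathfrak f_2)$, where $\Delta_{\mathrm{sh}}\mathfrak f_1=\sum\mathfrak f_1'\otimes\mathfrak f_1''$ and $\mathfrak g\,\bar\star\,\mathfrak f$ is the sum over all ways of attaching the root of each tree of $\mathfrak g$ by a new edge to some vertex of $\mathfrak f$. **Elementary differentials.** For smooth $f=(f_\alpha)_{\alpha\in[d]}$, $f_\alpha:\mathbb R^m\to\mathbb R^m$, a smooth function $\varphi$ on $\mathbb R^m$, and $\tau_1,\dots,\tau_n\in\mathcal T$ put $$\Upsilon_f[\mathcal B_+^\alpha(\tau_1\cdots\tau_n)](y)=\sum_{b\in[m]^n}\Big(\prod_{i=1}^n\Upsilon_f^{b_i}[\tau_i](y)\Big)\partial_{b_1}\cdots\partial_{b_n}f_\alpha(y),\qquad \Upsilon_f[\tau_1\cdots\tau_n]\{\varphi\}(y)=\sum_{b\in[m]^n}\Big(\prod_{i=1}^n\Upsilon_f^{b_i}[\tau_i](y)\Big)\partial_{b_1}\cdots\partial_{b_n}\varphi(y),$$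 extended linearly to $\mathcal H_{BCK}^*$, with $\Upsilon_f[\mathfrak f]=0$ for forests $\mathfrak f$ that are not single trees. **Theorem.** Let $(\mathcal H,\mu,\Delta)=\bigoplus_{n\ge0}\mathcal H_n$ be a commutative graded real Hopf algebra with finite-dimensional $\mathcal H_n$, and let $\mathcal H^*=\bigoplus_n\mathcal H_n^*$ be its graded dual, with product $\star$ and coproduct $\Delta_\mu$ given by $\langle u\star v,h\rangle=\langle u\otimes v,\Delta h\rangle$ and $\langle\Delta_\mu u,x\otimes y\rangle=\langle u,xy\rangle$. Assume that there are linear maps $L_\alpha:\mathcal H\to\mathcal H$, $\alpha\in[d]$, homogeneous of degree one, with $$\Delta L_\alpha(h)=(\mathrm{id}\otimes L_\alpha)\Delta h+L_\alpha(h)\otimes\mathbf 1\qquad(h\in\mathcal H),$$ such that $(L_\alpha(\mathbf 1))_{\alpha\in[d]}$ is a basis of $\mathcal H_1$, and a bilinear pairing on $\mathcal H$ with $\langle L_\alpha(x),L_\beta(y)\rangle_{\mathcal H}=\delta_{\alpha\beta}\langle x,y\rangle_{\mathcal H}$ for all $x,y\in\mathcal H$. Then: 1. there is a unique Hopf algebra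 morphism $\Lambda:(\mathcal H_{BCK},\odot,\Delta_{BCK})\to(\mathcal H,\mu,\Delta)$ with $\Lambda\circ\mathcal B_+^\alpha=L_\alpha\circ\Lambda$ for all $\alpha\in[d]$; 2. it has a dual map $\Lambda^*:\mathcal H^*\to\mathcal H_{BCK}^*$, i.e. $\langle\Lambda^*(u),x\rangle=\langle u,\Lambda(x)\rangle$ for all $u\in\mathcal H^*$, $x\in\mathcal H_{BCK}$, and $\Lambda^*:(\mathcal H^*,\star,\Delta_\mu)\to(\mathcal H_{BCK}^*,\star_{BCK},\Delta_{\mathrm{sh}})$ is a Hopf algebra morphism; 3. for all $m\in\mathbb N$ and all smooth $f_\alpha:\mathbb R^m\to\mathbb R^m$, the elementary differentials $\bar\Upsilon_f[h]=\Upsilon_f[\Lambda^*(h)]$ and $\bar\Upsilon_f[h]\{\varphi\}=\Upsilon_f[\Lambda^*(h)]\{\varphi\}$, $h\in\mathcal H^*$, are smooth for smooth $\varphi$, and for all $u,v\in\mathcal H^*$ $$\bar\Upsilon_f[u\star v]\{\varphi\}=\bar\Upsilon_f[u]\big\{\bar\Upsilon_f[v]\{\varphi\}\big\},\qquad \bar\Upsilon_f[\Delta_\mu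 u]\{\varphi\otimes\psi\}=\bar\Upsilon_f[u]\{\varphi\psi\}.$$ Here, in the first identity, $\varphi$ is any smooth function on $\mathbb R^m$ with values in a real normed space, and in the second one $\varphi,\psi$ are smooth with values in a commutative real normed algebra (for instance $\mathbb R$, or $\mathbb R^k$ with the componentwise product), $\bar\Upsilon_f[\,\cdot\,]\{\varphi\otimes\psi\}$ being the linear extension of $\bar\Upsilon_f[u\otimes v]\{\varphi\otimes\psi\}=\bar\Upsilon_f[u]\{\varphi\}\,\bar\Upsilon_f[v]\{\psi\}$. -/

import Mathlib

open scoped TensorProduct ContDiff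

noncomputable section

namespace FlowRDE

/-! ### Decorated non-planar rooted trees and forests -/

/-- The functor `X ↦ Fin d × Multiset X`: a root decoration and an unordered family of children. -/
def TreeF (d : ℕ) (X : Type) : Type := Fin d × Multiset X

instance instQPFTreeF (d : ℕ) : QPF (TreeF d) where
  map g x := (x.1, x.2.map g)
  P := ⟨Fin d × ℕ, fun p => Fin p.2⟩
  abs x := (x.1.1, (List.ofFn x.2 : Multiset _))
  repr x := ⟨(x.1, x.2.toList.length), x.2.toList.get⟩
  abs_repr := by
    rintro α ⟨a, s⟩
    exact Prod.ext rfl (by simp only [List.ofFn_get, Multiset.coe_toList])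
  abs_map := by
    rintro α β f ⟨⟨a, n⟩, p⟩
    exact Prod.ext rfl (by simp only [PFunctor.map, Multiset.map_coe, List.map_ofFn])

/-- Finite non-planar rooted trees with vertices decorated by `Fin d`: the initial algebra of
`X ↦ Fin d × Multiset X`. -/
def Tree (d : ℕ) : Type := QPF.Fix (TreeF d)

/-- Forests: finite unordered families (with repetitions) of trees. The empty forest is `0`. -/
abbrev Forest (d : ℕ) : Type := Multiset (Tree d)

instance instDecidableEqTree (d : ℕ) : DecidableEq (Tree d) := Classical.decEq _

namespace Tree

variable {d : ℕ}

/-- The tree whose root is decorated by `a` and whose branches are the trees of `s`. -/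
def node (a : Fin d) (s : Forest d) : Tree d := QPF.Fix.mk (F := TreeF d) (a, s)

/-- Structural recursion: `fold g (node a s) = g a (s.map (fold g))`. -/
def fold {β : Type} (g : Fin d → Multiset β → β) : Tree d → β :=
  QPF.Fix.rec (F := TreeF d) fun x => g x.1 x.2

theorem fold_node {β : Type} (g : Fin d → Multiset β → β) (a : Fin d) (s : Forest d) :
    fold g (node a s) = g a (s.map (fold g)) :=
  QPF.Fix.rec_eq (F := TreeF d) (fun x => g x.1 x.2) (a, s)

theorem induction {p : Tree d → Prop} (h : ∀ a s, (∀ t ∈ s, p t) → p (node a s)) (t : Tree d) :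
    p t := by
  refine QPF.Fix.ind (F := TreeF d) p ?_ t
  rintro ⟨a, s⟩ hs
  refine h a s ?_
  obtain ⟨⟨a', u⟩, hu⟩ := hs
  have h1 : u.map Subtype.val = s := congrArg Prod.snd hu
  intro t ht
  rw [← h1] at ht
  obtain ⟨x, -, rfl⟩ := Multiset.mem_map.1 ht
  exact x.2

/-- Structural recursion where the step may also use the branches themselves:
`para g (node a s) = g a (s.map fun t => (t, para g t))`. -/
def para {β : Type} (g : Fin d → Multiset (Tree d × β) → β) (t : Tree d) : β :=
  (fold (fun a s => (node a (s.map Prod.fst), g a s)) t).2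

theorem para_node {β : Type} (g : Fin d → Multiset (Tree d × β) → β) (a : Fin d) (s : Forest d) :
    para g (node a s) = g a (s.map fun t => (t, para g t)) := by
  have h : ∀ t : Tree d, (fold (fun a s => (node a (s.map Prod.fst), g a s)) t).1 = t := by
    refine induction fun a s ih => ?_
    rw [fold_node]
    simp only [Multiset.map_map, Function.comp_apply]
    rw [Multiset.map_congr rfl ih, Multiset.map_id']
  unfold para
  rw [fold_node]
  exact congrArg (g a) (Multiset.map_congr rfl fun t _ => Prod.ext (h t) rfl)

/-- The symmetry factor of a tree: `S (node a s) = ∏ r_j ! * S(τ_j) ^ r_j`, the product being over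
the distinct trees `τ_j` in `s`, of multiplicities `r_j`. -/
def symmFactor (t : Tree d) : ℕ :=
  para (fun _ s => by
    classical exact ∏ p ∈ s.toFinset, (s.count p).factorial * p.2 ^ s.count p) t

end Tree

/-- The symmetry factor of a forest. -/
def Forest.symmFactor {d : ℕ} (s : Forest d) : ℕ :=
  ∏ t ∈ s.toFinset, (s.count t).factorial * t.symmFactor ^ s.count t

/-! ### The Butcher-Connes-Kreimer Hopf algebra -/

/-- The real span of forests with the forest product `⊙` as multiplication. -/
def BCK (d : ℕ) : Type := AddMonoidAlgebra ℝ (Forest d)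

instance instCommRingBCK (d : ℕ) : CommRing (BCK d) :=
  inferInstanceAs (CommRing (AddMonoidAlgebra ℝ (Forest d)))

instance instAlgebraBCK (d : ℕ) : Algebra ℝ (BCK d) :=
  inferInstanceAs (Algebra ℝ (AddMonoidAlgebra ℝ (Forest d)))

namespace BCK

variable {d : ℕ}

/-- The basis of forests. -/
def basis (d : ℕ) : Module.Basis (Forest d) ℝ (BCK d) := AddMonoidAlgebra.basis (Forest d) ℝ

/-- The algebra morphism with prescribed values on trees. -/
def lift {A : Type*} [CommRing A] [Algebra ℝ A] (g : Tree d → A) : BCK d →ₐ[ℝ] A :=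
  AddMonoidAlgebra.lift ℝ A (Forest d)
    { toFun := fun s => (s.toAdd.map g).prod
      map_one' := by simp
      map_mul' := by simp }

theorem basis_zero : basis d 0 = 1 := rfl

theorem basis_add (s t : Forest d) : basis d (s + t) = basis d s * basis d t := by
  refine Eq.symm ((AddMonoidAlgebra.single_mul_single s t (1 : ℝ) 1).trans ?_)
  rw [mul_one]
  rfl

theorem lift_basis {A : Type*} [CommRing A] [Algebra ℝ A] (g : Tree d → A) (s : Forest d) :
    lift g (basis d s) = (s.map g).prod := by
  refine (AddMonoidAlgebra.lift_single _ s (1 : ℝ)).trans ?_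
  rw [one_smul]
  rfl

theorem algHom_ext {A : Type*} [Semiring A] [Algebra ℝ A] {g h : BCK d →ₐ[ℝ] A}
    (H : ∀ t, g (basis d {t}) = h (basis d {t})) : g = h := by
  have key : ∀ s, g (basis d s) = h (basis d s) := by
    intro s
    induction s using Multiset.induction_on with
    | empty => rw [basis_zero, map_one, map_one]
    | cons t s ih => rw [← Multiset.singleton_add, basis_add, map_mul, map_mul, H, ih]
  ext x
  exact congrArg (fun l : BCK d →ₗ[ℝ] A => l x)
    ((basis d).ext (f₁ := g.toLinearMap) (f₂ := h.toLinearMap) key)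

/-- The operator `B_+^a` joining the trees of a forest to a new root decorated by `a`. -/
def bPlus (a : Fin d) : BCK d →ₗ[ℝ] BCK d :=
  (basis d).constr ℝ fun s => basis d {Tree.node a s}

theorem bPlus_basis (a : Fin d) (s : Forest d) :
    bPlus a (basis d s) = basis d {Tree.node a s} := (basis d).constr_basis _ _ _

/-- The coproduct of a tree, determined by
`Δ (B_+^a s) = (id ⊗ B_+^a) (Δ s) + B_+^a s ⊗ 1`, where `Δ s` is the product of the coproducts of
the trees in `s`. -/
def comulTree : Tree d → BCK d ⊗[ℝ] BCK d :=
  Tree.para fun a s => (bPlus a).lTensor (BCK d) (s.map Prod.snd).prod +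
    basis d {Tree.node a (s.map Prod.fst)} ⊗ₜ[ℝ] 1

theorem comulTree_node (a : Fin d) (s : Forest d) :
    comulTree (Tree.node a s) = (bPlus a).lTensor (BCK d) (s.map comulTree).prod +
      basis d {Tree.node a s} ⊗ₜ[ℝ] 1 := by
  rw [comulTree, Tree.para_node]
  simp [Multiset.map_map]

/-- The Butcher-Connes-Kreimer coproduct. -/
def comulHom (d : ℕ) : BCK d →ₐ[ℝ] BCK d ⊗[ℝ] BCK d := lift comulTree

/-- The counit: the coefficient of the empty forest. -/
def counitHom (d : ℕ) : BCK d →ₐ[ℝ] ℝ := lift fun _ => 0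

theorem comulHom_bPlus (a : Fin d) (x : BCK d) :
    comulHom d (bPlus a x) =
      (bPlus a).lTensor (BCK d) (comulHom d x) + bPlus a x ⊗ₜ[ℝ] 1 := by
  have : (comulHom d).toLinearMap ∘ₗ bPlus a =
      (bPlus a).lTensor (BCK d) ∘ₗ (comulHom d).toLinearMap +
        (TensorProduct.mk ℝ (BCK d) (BCK d)).flip 1 ∘ₗ bPlus a := by
    refine (basis d).ext fun s => ?_
    simp only [LinearMap.comp_apply, LinearMap.add_apply, AlgHom.toLinearMap_apply, bPlus_basis,
      LinearMap.flip_apply, TensorProduct.mk_apply]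
    simp only [comulHom, lift_basis, Multiset.map_singleton, Multiset.prod_singleton,
      comulTree_node]
  exact LinearMap.congr_fun this x

theorem counitHom_bPlus (a : Fin d) (x : BCK d) : counitHom d (bPlus a x) = 0 := by
  have : (counitHom d).toLinearMap ∘ₗ bPlus a = 0 := by
    refine (basis d).ext fun s => ?_
    simp [bPlus_basis, counitHom, lift_basis]
  exact LinearMap.congr_fun this x

/-- An identity between algebra morphisms may be checked on `B_+^a s`, assuming it for `s`. -/
theorem algHom_ext_bPlus {A : Type*} [Semiring A] [Algebra ℝ A] {g h : BCK d →ₐ[ℝ] A}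
    (H : ∀ a x, g x = h x → g (bPlus a x) = h (bPlus a x)) : g = h := by
  refine algHom_ext fun t => ?_
  induction t using Tree.induction with
  | h a s ih =>
    rw [← bPlus_basis]
    refine H a _ ?_
    induction s using Multiset.induction_on with
    | empty => rw [basis_zero, map_one, map_one]
    | cons t s ih' =>
      rw [← Multiset.singleton_add, basis_add, map_mul, map_mul, ih t (Multiset.mem_cons_self t s),
        ih' fun u hu => ih u (Multiset.mem_cons_of_mem hu)]

theorem coassoc (d : ℕ) :
    (Algebra.TensorProduct.assoc ℝ ℝ ℝ (BCK d) (BCK d) (BCK d)).toAlgHom.comp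
      ((Algebra.TensorProduct.map (comulHom d) (.id ℝ (BCK d))).comp (comulHom d)) =
      (Algebra.TensorProduct.map (.id ℝ (BCK d)) (comulHom d)).comp (comulHom d) := by
  refine algHom_ext_bPlus fun a x hx => ?_
  simp only [AlgHom.comp_apply] at hx ⊢
  rw [comulHom_bPlus, map_add, map_add, map_add]
  have h1 : ∀ w : BCK d ⊗[ℝ] BCK d,
      (Algebra.TensorProduct.assoc ℝ ℝ ℝ (BCK d) (BCK d) (BCK d)).toAlgHom
        (Algebra.TensorProduct.map (comulHom d) (.id ℝ (BCK d)) ((bPlus a).lTensor (BCK d) w)) =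
      ((bPlus a).lTensor (BCK d)).lTensor (BCK d)
        ((Algebra.TensorProduct.assoc ℝ ℝ ℝ (BCK d) (BCK d) (BCK d)).toAlgHom
          (Algebra.TensorProduct.map (comulHom d) (.id ℝ (BCK d)) w)) := by
    intro w
    induction w with
    | zero => simp
    | add u v hu hv => simp only [map_add, hu, hv]
    | tmul u v =>
      simp only [LinearMap.lTensor_tmul, Algebra.TensorProduct.map_tmul, AlgHom.id_apply]
      generalize comulHom d u = z
      induction z with
      | zero => simp
      | add p q hp hq => simp only [TensorProduct.add_tmul, map_add, hp, hq]
      | tmul p q => simp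
  have h2 : ∀ w : BCK d ⊗[ℝ] BCK d,
      Algebra.TensorProduct.map (.id ℝ (BCK d)) (comulHom d) ((bPlus a).lTensor (BCK d) w) =
      ((bPlus a).lTensor (BCK d)).lTensor (BCK d)
          (Algebra.TensorProduct.map (.id ℝ (BCK d)) (comulHom d) w) +
        (Algebra.TensorProduct.assoc ℝ ℝ ℝ (BCK d) (BCK d) (BCK d)).toAlgHom
          (((bPlus a).lTensor (BCK d) w) ⊗ₜ[ℝ] 1) := by
    intro w
    induction w with
    | zero => simp
    | add u v hu hv => simp only [map_add, hu, hv, TensorProduct.add_tmul]; abel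
    | tmul u v => simp [comulHom_bPlus, TensorProduct.tmul_add]
  rw [h1, hx, h2]
  simp [comulHom_bPlus, TensorProduct.add_tmul, Algebra.TensorProduct.one_def, add_assoc]

theorem counit_comul (d : ℕ) :
    (Algebra.TensorProduct.map (counitHom d) (.id ℝ (BCK d))).comp (comulHom d) =
      (Algebra.TensorProduct.lid ℝ (BCK d)).symm := by
  refine algHom_ext_bPlus fun a x hx => ?_
  simp only [AlgHom.comp_apply] at hx ⊢
  have h1 : ∀ w : BCK d ⊗[ℝ] BCK d,
      Algebra.TensorProduct.map (counitHom d) (.id ℝ (BCK d)) ((bPlus a).lTensor (BCK d) w) =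
      (bPlus a).lTensor ℝ (Algebra.TensorProduct.map (counitHom d) (.id ℝ (BCK d)) w) := by
    intro w
    induction w with
    | zero => simp
    | add u v hu hv => simp only [map_add, hu, hv]
    | tmul u v => simp
  rw [comulHom_bPlus, map_add, h1, hx]
  simp [counitHom_bPlus]

theorem comul_counit (d : ℕ) :
    (Algebra.TensorProduct.map (.id ℝ (BCK d)) (counitHom d)).comp (comulHom d) =
      (Algebra.TensorProduct.rid ℝ ℝ (BCK d)).symm := by
  refine algHom_ext_bPlus fun a x hx => ?_
  simp only [AlgHom.comp_apply] at hx ⊢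
  have h1 : ∀ w : BCK d ⊗[ℝ] BCK d,
      Algebra.TensorProduct.map (.id ℝ (BCK d)) (counitHom d) ((bPlus a).lTensor (BCK d) w) = 0 := by
    intro w
    induction w with
    | zero => simp
    | add u v hu hv => simp only [map_add, hu, hv, add_zero]
    | tmul u v => simp [counitHom_bPlus]
  rw [comulHom_bPlus, map_add, h1]
  simp

instance instBialgebra (d : ℕ) : Bialgebra ℝ (BCK d) :=
  .ofAlgHom (comulHom d) (counitHom d) (coassoc d) (counit_comul d) (comul_counit d)

end BCK

/-! ### The dual Hopf algebra of forests -/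

/-- The graded dual of `BCK d`, identified with the real span of forests through the pairing
`BCKDual.pairing` below. Its multiplication as a ring is the forest product `⊙`, its coalgebra
structure is the unshuffle coproduct, and `BCKDual.star` is the product dual to the coproduct
of `BCK d`. -/
def BCKDual (d : ℕ) : Type := BCK d

instance instCommRingBCKDual (d : ℕ) : CommRing (BCKDual d) := inferInstanceAs (CommRing (BCK d))

instance instAlgebraBCKDual (d : ℕ) : Algebra ℝ (BCKDual d) := inferInstanceAs (Algebra ℝ (BCK d))

namespace BCKDual

variable {d : ℕ}

/-- The basis of forests. -/
def basis (d : ℕ) : Module.Basis (Forest d) ℝ (BCKDual d) := BCK.basis d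

/-- The pairing of forests `⟨s, t⟩ = S(t)` if `s = t`, and `0` otherwise. -/
def pairing (d : ℕ) : BCKDual d →ₗ[ℝ] BCK d →ₗ[ℝ] ℝ :=
  (basis d).constr ℝ fun s => (BCK.basis d).constr ℝ fun t => if s = t then (t.symmFactor : ℝ) else 0

/-- The operator `B_+^a` joining the trees of a forest to a new root decorated by `a`. -/
def bPlus (a : Fin d) : BCKDual d →ₗ[ℝ] BCKDual d :=
  (basis d).constr ℝ fun s => basis d {Tree.node a s}

/-- The unshuffle coproduct: trees are primitive and the coproduct is multiplicative for `⊙`. -/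
def comulHom (d : ℕ) : BCKDual d →ₐ[ℝ] BCKDual d ⊗[ℝ] BCKDual d :=
  BCK.lift fun t => basis d {t} ⊗ₜ[ℝ] 1 + 1 ⊗ₜ[ℝ] basis d {t}

theorem comulHom_basis_singleton (t : Tree d) :
    comulHom d (basis d {t}) = basis d {t} ⊗ₜ[ℝ] 1 + 1 ⊗ₜ[ℝ] basis d {t} :=
  (BCK.lift_basis _ _).trans (by simp)

/-- The counit: the coefficient of the empty forest. -/
def counitHom (d : ℕ) : BCKDual d →ₐ[ℝ] ℝ := BCK.lift fun _ => 0

theorem counitHom_basis_singleton (t : Tree d) : counitHom d (basis d {t}) = 0 :=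
  (BCK.lift_basis _ _).trans (by simp)

theorem algHom_ext {A : Type*} [Semiring A] [Algebra ℝ A] {g h : BCKDual d →ₐ[ℝ] A}
    (H : ∀ t, g (basis d {t}) = h (basis d {t})) : g = h :=
  BCK.algHom_ext H

instance instBialgebra (d : ℕ) : Bialgebra ℝ (BCKDual d) :=
  .ofAlgHom (comulHom d) (counitHom d)
    (algHom_ext fun t => by
      simp [comulHom_basis_singleton, TensorProduct.add_tmul, TensorProduct.tmul_add,
        Algebra.TensorProduct.one_def, add_assoc])
    (algHom_ext fun t => by simp [comulHom_basis_singleton, counitHom_basis_singleton])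
    (algHom_ext fun t => by simp [comulHom_basis_singleton, counitHom_basis_singleton])

instance instIsCocomm (d : ℕ) : Coalgebra.IsCocomm ℝ (BCKDual d) where
  comm_comp_comul := by
    have h : (Algebra.TensorProduct.comm ℝ (BCKDual d) (BCKDual d)).toAlgHom.comp (comulHom d) =
        comulHom d :=
      algHom_ext fun t => by simp [comulHom_basis_singleton, add_comm]
    exact congrArg AlgHom.toLinearMap h

/-- Simultaneous grafting `u ↦ u ⋆̄ t` of forests onto the vertices of a tree. Each tree of `u` is
attached either to the root of `t = node a s` or to a vertex of one of the branches in `s`; so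
`u ⋆̄ node a s = B_+^a (∑ u₀ ⊙ ∏_{t ∈ s} (u_t ⋆̄ t))`, the sum being over all ways of distributing the
trees of `u` among the root and the branches. Such a sum is a product for the convolution
`(A * B) u = ∑ A(u') ⊙ B(u'')` along the unshuffle coproduct `u ↦ ∑ u' ⊗ u''`. -/
def graftTree : Tree d → WithConv (BCKDual d →ₗ[ℝ] BCKDual d) :=
  Tree.fold fun a G => WithConv.toConv
    (bPlus a ∘ₗ (WithConv.toConv (LinearMap.id : BCKDual d →ₗ[ℝ] BCKDual d) * G.prod).ofConv)

/-- Simultaneous grafting `u ↦ u ⋆̄ s` onto the vertices of a forest: the trees of `u` are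
distributed in all ways among the trees of `s`. -/
def graft (s : Forest d) : BCKDual d →ₗ[ℝ] BCKDual d := (s.map graftTree).prod.ofConv

/-- The product `u ⋆ v = M_⊙ ((id ⊗ (· ⋆̄ v)) (Δ u))`, with `Δ` the unshuffle coproduct. -/
def star (d : ℕ) : BCKDual d →ₗ[ℝ] BCKDual d →ₗ[ℝ] BCKDual d :=
  LinearMap.flip <| (basis d).constr ℝ fun s =>
    LinearMap.mul' ℝ (BCKDual d) ∘ₗ (graft s).lTensor (BCKDual d) ∘ₗ Coalgebra.comul

end BCKDual

/-! ### Graded Hopf algebras and their graded duals -/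

section GradedDual

variable {H : Type*} [CommRing H] [HopfAlgebra ℝ H]

/-- A grading `H = ⨁ H_n` of the algebra `H` makes it a graded Hopf algebra of finite type: the
coproduct and the counit are homogeneous and every `H_n` has finite dimension. -/
class IsGradedHopf (𝒜 : ℕ → Submodule ℝ H) [GradedAlgebra 𝒜] : Prop where
  comul_mem : ∀ n, ∀ x ∈ 𝒜 n, (Coalgebra.comul x : H ⊗[ℝ] H) ∈
    ⨆ p ∈ Finset.HasAntidiagonal.antidiagonal n,
      LinearMap.range (TensorProduct.map (𝒜 p.1).subtype (𝒜 p.2).subtype)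
  counit_eq_zero : ∀ n, n ≠ 0 → ∀ x ∈ 𝒜 n, (Coalgebra.counit x : ℝ) = 0
  finite : ∀ n, FiniteDimensional ℝ (𝒜 n)

/-- The graded dual `⨁ H_n^*`: linear forms vanishing on `H_n` for all but finitely many `n`. -/
def gradedDual (𝒜 : ℕ → Submodule ℝ H) : Submodule ℝ (Module.Dual ℝ H) where
  carrier := {u | ∃ N, ∀ n, N ≤ n → ∀ x ∈ 𝒜 n, u x = 0}
  zero_mem' := ⟨0, fun _ _ _ _ => rfl⟩
  add_mem' := by
    rintro u v ⟨N, hN⟩ ⟨M, hM⟩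
    refine ⟨max N M, fun n hn x hx => ?_⟩
    rw [LinearMap.add_apply, hN n (le_trans (le_max_left _ _) hn) x hx,
      hM n (le_trans (le_max_right _ _) hn) x hx, add_zero]
  smul_mem' := by
    rintro c u ⟨N, hN⟩
    refine ⟨N, fun n hn x hx => ?_⟩
    rw [LinearMap.smul_apply, hN n hn x hx, smul_zero]

/-- Elements of the tensor square of the graded dual as linear forms on `H ⊗ H`:
`⟨u ⊗ v, x ⊗ y⟩ = u(x) v(y)`. -/
def dualPair (𝒜 : ℕ → Submodule ℝ H) :
    gradedDual 𝒜 ⊗[ℝ] gradedDual 𝒜 →ₗ[ℝ] Module.Dual ℝ (H ⊗[ℝ] H) :=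
  TensorProduct.dualDistrib ℝ H H ∘ₗ
    TensorProduct.map (gradedDual 𝒜).subtype (gradedDual 𝒜).subtype

theorem dualPair_injective (𝒜 : ℕ → Submodule ℝ H) : Function.Injective (dualPair 𝒜) := by
  classical
  let b := Module.Basis.ofVectorSpace ℝ (gradedDual 𝒜)
  let e := TensorProduct.equivFinsuppOfBasisRight (M := gradedDual 𝒜) b
  have heval : ∀ (c : _ →₀ gradedDual 𝒜) (x y : H), dualPair 𝒜 (e.symm c) (x ⊗ₜ[ℝ] y) =
      (Finsupp.linearCombination ℝ b
        (c.mapRange (fun g : gradedDual 𝒜 => g.1 x) rfl) : gradedDual 𝒜).1 y := by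
    intro c x y
    rw [TensorProduct.equivFinsuppOfBasisRight_symm_apply, Finsupp.linearCombination_apply,
      Finsupp.sum_mapRange_index (by simp)]
    simp [dualPair, Finsupp.sum, map_sum, TensorProduct.dualDistrib_apply]
  intro w₁ w₂ hw
  obtain ⟨c₁, rfl⟩ := e.symm.surjective w₁
  obtain ⟨c₂, rfl⟩ := e.symm.surjective w₂
  refine congrArg e.symm (Finsupp.ext fun i => Subtype.ext (LinearMap.ext fun x => ?_))
  refine DFunLike.congr_fun (b.linearIndependent (a₁ := c₁.mapRange (fun g => g.1 x) rfl)
    (a₂ := c₂.mapRange (fun g => g.1 x) rfl) (Subtype.ext (LinearMap.ext fun y => ?_))) i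
  rw [← heval, ← heval, hw]

variable (𝒜 : ℕ → Submodule ℝ H) [GradedAlgebra 𝒜] [IsGradedHopf 𝒜]

/-- The unit of the graded dual is the counit of `H`. -/
def dualOne : gradedDual 𝒜 :=
  ⟨Coalgebra.counit, 1, fun n hn x hx =>
    IsGradedHopf.counit_eq_zero (𝒜 := 𝒜) n (Nat.one_le_iff_ne_zero.1 hn) x hx⟩

variable {𝒜}

/-- The product of the graded dual: `⟨u ⋆ v, h⟩ = ⟨u ⊗ v, Δ h⟩`. -/
def dualStar (u v : gradedDual 𝒜) : gradedDual 𝒜 :=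
  ⟨TensorProduct.dualDistrib ℝ H H (u.1 ⊗ₜ[ℝ] v.1) ∘ₗ Coalgebra.comul, by
    obtain ⟨u, N, hN⟩ := u
    obtain ⟨v, M, hM⟩ := v
    refine ⟨N + M, fun n hn x hx => ?_⟩
    have hle : (⨆ p ∈ Finset.HasAntidiagonal.antidiagonal n,
        LinearMap.range (TensorProduct.map (𝒜 p.1).subtype (𝒜 p.2).subtype)) ≤
        LinearMap.ker (TensorProduct.dualDistrib ℝ H H (u ⊗ₜ[ℝ] v)) := by
      refine iSup₂_le fun p hp => ?_
      rw [LinearMap.range_le_ker_iff]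
      refine TensorProduct.ext' fun a b => ?_
      simp only [LinearMap.comp_apply, TensorProduct.map_tmul, Submodule.subtype_apply,
        TensorProduct.dualDistrib_apply, LinearMap.zero_apply]
      have hp' : p.1 + p.2 = n := Finset.HasAntidiagonal.mem_antidiagonal.1 hp
      rcases Nat.lt_or_ge p.1 N with h | h
      · rw [hM p.2 (by omega) _ b.2, mul_zero]
      · rw [hN p.1 h _ a.2, zero_mul]
    exact hle (IsGradedHopf.comul_mem n x hx)⟩

variable (𝒜)

/-- The extension by zero of a linear form on `H_p` to an element of the graded dual. -/
def dualExtend (p : ℕ) : Module.Dual ℝ (𝒜 p) →ₗ[ℝ] gradedDual 𝒜 :=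
  LinearMap.codRestrict (gradedDual 𝒜)
    (DirectSum.component ℝ ℕ (fun i => 𝒜 i) p ∘ₗ
      (DirectSum.decomposeLinearEquiv 𝒜).toLinearMap).dualMap fun g => by
    refine ⟨p + 1, fun n hn x hx => ?_⟩
    have h : DirectSum.component ℝ ℕ (fun i => 𝒜 i) p (DirectSum.decompose 𝒜 x) = 0 := by
      rw [DirectSum.decompose_of_mem 𝒜 hx]
      exact DirectSum.of_eq_of_ne _ _ _ (by omega)
    exact (congrArg g h).trans (map_zero g)

/-- `u ∘ μ` lies in `H^* ⊗ H^*`, as the graded pieces of `H` are finite-dimensional. -/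
theorem mul_mem_range_dualPair (u : gradedDual 𝒜) :
    u.1 ∘ₗ LinearMap.mul' ℝ H ∈ LinearMap.range (dualPair 𝒜) := by
  have := IsGradedHopf.finite (𝒜 := 𝒜)
  obtain ⟨u, N, hN⟩ := u
  let π : ∀ p, H →ₗ[ℝ] 𝒜 p := fun p => DirectSum.component ℝ ℕ (fun i => 𝒜 i) p ∘ₗ
      (DirectSum.decomposeLinearEquiv 𝒜).toLinearMap
  have hπ : ∀ p x, π p x = DirectSum.decompose 𝒜 x p := fun p x => rfl
  have hterm : ∀ p q, (u ∘ₗ LinearMap.mul' ℝ H ∘ₗ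
      TensorProduct.map (𝒜 p).subtype (𝒜 q).subtype) ∘ₗ TensorProduct.map (π p) (π q) ∈
      LinearMap.range (dualPair 𝒜) := by
    intro p q
    obtain ⟨z, hz⟩ := (TensorProduct.dualDistribEquiv ℝ (𝒜 p) (𝒜 q)).surjective
      (u ∘ₗ LinearMap.mul' ℝ H ∘ₗ TensorProduct.map (𝒜 p).subtype (𝒜 q).subtype)
    refine ⟨TensorProduct.map (dualExtend 𝒜 p) (dualExtend 𝒜 q) z, ?_⟩
    rw [← hz]
    have : dualPair 𝒜 ∘ₗ TensorProduct.map (dualExtend 𝒜 p) (dualExtend 𝒜 q) =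
        (TensorProduct.map (π p) (π q)).dualMap ∘ₗ
          TensorProduct.dualDistrib ℝ (𝒜 p) (𝒜 q) := by
      refine TensorProduct.ext' fun g h => TensorProduct.ext' fun x y => ?_
      rfl
    exact LinearMap.congr_fun this z
  have hsum : u ∘ₗ LinearMap.mul' ℝ H = ∑ p ∈ Finset.range N, ∑ q ∈ Finset.range N,
      (u ∘ₗ LinearMap.mul' ℝ H ∘ₗ
        TensorProduct.map (𝒜 p).subtype (𝒜 q).subtype) ∘ₗ TensorProduct.map (π p) (π q) := by
    refine TensorProduct.ext' fun x y => ?_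
    have hx : ∀ x, ∀ y, u (x * y) = ∑ p ∈ Finset.range N, u (π p x * y) := by
      intro x y
      induction x using DirectSum.Decomposition.inductionOn 𝒜 with
      | zero => simp
      | add a b ha hb => simp only [add_mul, map_add, ha, hb, Submodule.coe_add,
          Finset.sum_add_distrib]
      | @homogeneous i a =>
        have ha : ∀ p, p ≠ i → (π p (a : H) : H) = 0 := fun p hp => by
          rw [hπ, DirectSum.decompose_of_mem_ne 𝒜 a.2 (Ne.symm hp)]
        rcases Nat.lt_or_ge i N with h | h
        · rw [Finset.sum_eq_single_of_mem i (Finset.mem_range.2 h) fun p _ hp => by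
            rw [ha p hp, zero_mul, map_zero], hπ, DirectSum.decompose_of_mem_same 𝒜 a.2]
        · rw [Finset.sum_eq_zero fun p hp => by
            rw [ha p (by have := Finset.mem_range.1 hp; omega), zero_mul, map_zero]]
          induction y using DirectSum.Decomposition.inductionOn 𝒜 with
          | zero => simp
          | add b c hb hc => rw [mul_add, map_add, hb, hc, add_zero]
          | @homogeneous j b =>
            exact hN (i + j) (by omega) _ (SetLike.mul_mem_graded a.2 b.2)
    simp only [LinearMap.sum_apply, LinearMap.comp_apply, TensorProduct.map_tmul,
      LinearMap.mul'_apply, Submodule.subtype_apply]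
    rw [hx x y]
    refine Finset.sum_congr rfl fun p _ => ?_
    rw [mul_comm, hx y]
    exact Finset.sum_congr rfl fun q _ => by rw [mul_comm]
  change u ∘ₗ LinearMap.mul' ℝ H ∈ _
  rw [hsum]
  exact Submodule.sum_mem _ fun p _ => Submodule.sum_mem _ fun q _ => hterm p q

/-- The coproduct of the graded dual, characterised by `⟨Δ_μ u, x ⊗ y⟩ = ⟨u, x y⟩`. -/
def dualComul : gradedDual 𝒜 →ₗ[ℝ] gradedDual 𝒜 ⊗[ℝ] gradedDual 𝒜 :=
  (LinearEquiv.ofInjective (dualPair 𝒜) (dualPair_injective 𝒜)).symm.toLinearMap ∘ₗ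
    LinearMap.codRestrict (LinearMap.range (dualPair 𝒜))
      ((LinearMap.mul' ℝ H).dualMap ∘ₗ (gradedDual 𝒜).subtype) (mul_mem_range_dualPair 𝒜)

theorem dualPair_dualComul (u : gradedDual 𝒜) (x y : H) :
    dualPair 𝒜 (dualComul 𝒜 u) (x ⊗ₜ[ℝ] y) = u.1 (x * y) := by
  have h := LinearEquiv.apply_symm_apply
    (LinearEquiv.ofInjective (dualPair 𝒜) (dualPair_injective 𝒜))
    (LinearMap.codRestrict (LinearMap.range (dualPair 𝒜))
      ((LinearMap.mul' ℝ H).dualMap ∘ₗ (gradedDual 𝒜).subtype) (mul_mem_range_dualPair 𝒜) u)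
  exact LinearMap.congr_fun (congrArg Subtype.val h) (x ⊗ₜ[ℝ] y)

/-- The algebraic fixed point assumption: the `L_a` are linear maps, homogeneous of degree one,
satisfying the cocycle identity; `(L_a 1)_a` is a basis of `H_1`; and the pairing satisfies
`⟨L_a x, L_b y⟩ = δ_{ab} ⟨x, y⟩`. -/
structure FixedPointAssumption {d : ℕ} (𝒜 : ℕ → Submodule ℝ H) (L : Fin d → H →ₗ[ℝ] H)
    (B : H →ₗ[ℝ] H →ₗ[ℝ] ℝ) : Prop where
  homogeneous : ∀ a n, ∀ x ∈ 𝒜 n, L a x ∈ 𝒜 (n + 1)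
  cocycle : ∀ a x, (Coalgebra.comul (L a x) : H ⊗[ℝ] H) =
    (L a).lTensor H (Coalgebra.comul x) + L a x ⊗ₜ[ℝ] 1
  linearIndependent : LinearIndependent ℝ fun a => L a 1
  span_eq : Submodule.span ℝ (Set.range fun a => L a 1) = 𝒜 1
  pairing : ∀ a b x y, B (L a x) (L b y) = if a = b then B x y else 0

end GradedDual

/-! ### Elementary differentials and elementary vector fields -/

section Elementary

variable {d m : ℕ}

/-- `∑_{b ∈ [m]^n} (∏ i, v_i^{b_i}) ∂_{b_1} ⋯ ∂_{b_n} φ (y)` for a list `v_1, …, v_n` of vectors. -/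
def listDeriv {V : Type*} [NormedAddCommGroup V] [NormedSpace ℝ V] (φ : (Fin m → ℝ) → V)
    (v : List (Fin m → ℝ)) (y : Fin m → ℝ) : V :=
  ∑ b : Fin v.length → Fin m, (∏ i, v.get i (b i)) •
    iteratedFDeriv ℝ v.length φ y fun i => Pi.single (b i) 1

/-- The same for an unordered family of vectors. For smooth `φ` the value does not depend on the
chosen ordering, since partial derivatives commute. -/
def multisetDeriv {V : Type*} [NormedAddCommGroup V] [NormedSpace ℝ V] (φ : (Fin m → ℝ) → V)
    (v : Multiset (Fin m → ℝ)) (y : Fin m → ℝ) : V :=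
  listDeriv φ v.toList y

/-- The elementary differential of a tree:
`Υ_f[B_+^a(τ_1 ⋯ τ_n)](y) = ∑_b (∏ i, Υ_f^{b_i}[τ_i](y)) ∂_{b_1} ⋯ ∂_{b_n} f_a (y)`. -/
def elemDiffTree (f : Fin d → (Fin m → ℝ) → Fin m → ℝ) : Tree d → (Fin m → ℝ) → Fin m → ℝ :=
  Tree.fold fun a s y => multisetDeriv (f a) (s.map fun g => g y) y

/-- The elementary differential, extended linearly; it vanishes on forests that are not trees. -/
def elemDiff (f : Fin d → (Fin m → ℝ) → Fin m → ℝ) :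
    BCKDual d →ₗ[ℝ] (Fin m → ℝ) → Fin m → ℝ :=
  (BCKDual.basis d).constr ℝ fun s =>
    if Multiset.card s = 1 then (s.map (elemDiffTree f)).sum else 0

/-- The elementary vector field `Υ_f[·]{φ}`, the linear extension of
`Υ_f[τ_1 ⋯ τ_n]{φ}(y) = ∑_b (∏ i, Υ_f^{b_i}[τ_i](y)) ∂_{b_1} ⋯ ∂_{b_n} φ (y)`. -/
def elemField {V : Type*} [NormedAddCommGroup V] [NormedSpace ℝ V]
    (f : Fin d → (Fin m → ℝ) → Fin m → ℝ) (φ : (Fin m → ℝ) → V) :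
    BCKDual d →ₗ[ℝ] (Fin m → ℝ) → V :=
  (BCKDual.basis d).constr ℝ fun s y => multisetDeriv φ (s.map fun t => elemDiffTree f t y) y

variable {H : Type*} [CommRing H] [HopfAlgebra ℝ H] {𝒜 : ℕ → Submodule ℝ H}

/-- The elementary differentials `Ῡ_f[h] = Υ_f[Λ^*(h)]` on the graded dual of `H`. -/
def barElemDiff (Λs : gradedDual 𝒜 →ₗ[ℝ] BCKDual d) (f : Fin d → (Fin m → ℝ) → Fin m → ℝ) :
    gradedDual 𝒜 →ₗ[ℝ] (Fin m → ℝ) → Fin m → ℝ :=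
  elemDiff f ∘ₗ Λs

/-- The elementary vector fields `Ῡ_f[h]{φ} = Υ_f[Λ^*(h)]{φ}` on the graded dual of `H`. -/
def barElemField {V : Type*} [NormedAddCommGroup V] [NormedSpace ℝ V]
    (Λs : gradedDual 𝒜 →ₗ[ℝ] BCKDual d) (f : Fin d → (Fin m → ℝ) → Fin m → ℝ)
    (φ : (Fin m → ℝ) → V) : gradedDual 𝒜 →ₗ[ℝ] (Fin m → ℝ) → V :=
  elemField f φ ∘ₗ Λs

/-- The linear extension of `Ῡ_f[u ⊗ v]{φ ⊗ ψ}(y) = Ῡ_f[u]{φ}(y) Ῡ_f[v]{ψ}(y)`. -/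
def barElemFieldTensor {A : Type*} [NormedCommRing A] [NormedAlgebra ℝ A]
    (Λs : gradedDual 𝒜 →ₗ[ℝ] BCKDual d) (f : Fin d → (Fin m → ℝ) → Fin m → ℝ)
    (φ ψ : (Fin m → ℝ) → A) : gradedDual 𝒜 ⊗[ℝ] gradedDual 𝒜 →ₗ[ℝ] (Fin m → ℝ) → A :=
  LinearMap.mul' ℝ ((Fin m → ℝ) → A) ∘ₗ
    TensorProduct.map (barElemField Λs f φ) (barElemField Λs f ψ)

end Elementary

/-- `Λs` is a morphism of bialgebras (hence of Hopf algebras) from the graded dual of `H`, with the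
product `⋆` and the coproduct `Δ_μ`, to the dual of the Butcher-Connes-Kreimer Hopf algebra, with
the product `⋆` of forests and the unshuffle coproduct. -/
structure IsDualMorphism {d : ℕ} {H : Type*} [CommRing H] [HopfAlgebra ℝ H]
    (𝒜 : ℕ → Submodule ℝ H) [GradedAlgebra 𝒜] [IsGradedHopf 𝒜]
    (Λs : gradedDual 𝒜 →ₗ[ℝ] BCKDual d) : Prop where
  map_star : ∀ u v, Λs (dualStar u v) = BCKDual.star d (Λs u) (Λs v)
  map_one : Λs (dualOne 𝒜) = 1
  map_comul : ∀ u, Coalgebra.comul (Λs u) = TensorProduct.map Λs Λs (dualComul 𝒜 u)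
  map_counit : ∀ u, (Coalgebra.counit (Λs u) : ℝ) = u.1 1

end FlowRDE

end

noncomputable section

namespace FlowRDE

/-! ### Recursion on trees in arbitrary universes, and sizes -/

namespace Tree

variable {d : ℕ}

/-! `BCK d` is the polynomial algebra on trees, and every tree is `B_+^a` of a forest. An algebra
morphism out of it is thus determined by how it intertwines the `B_+^a`: recursion on trees produces
`Λ`, and `BCK.algHom_ext_bPlus` reduces an identity of algebra morphisms to arguments `B_+^a x`,
given the identity at `x`. There the cocycle identities of `B_+^a` and `L a` match, so `Λ` respects
the coproducts; uniqueness follows from the same principle.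

As `L a` raises degrees by one, `Λ` sends a forest with `n` vertices into `𝒜 n`. A form `u` in the
graded dual therefore sees only finitely many forests, and `Λ^* u = ∑_s u(Λ s) / S(s) • s` is a
finite sum. Its morphism properties are the transposes of those of `Λ`, once the pairing is known to
turn the forest product into the unshuffle coproduct (`pairing_mul`) and the coproduct of `BCK d`
into `⋆` (`pairing_star`).

The second duality rests on convolution algebras. Grafting is an algebra morphism `graftHom` from
forests to a convolution algebra, so many of its properties need checking on single trees only. This
yields that `⋆` is a morphism of coalgebras (`comul_star`). Hence both sides of `pairing_star` are
algebra morphisms in `x`, and on `B_+^a x` the claim becomes `bMinus_star`, the transpose of the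
cocycle identity.

On the analytic side everything follows from `elemField_tree_mul`, which pulls one tree out of a
forest. The product rule for `∂_b` gives `elemField_mul`. For compositions, letting `u` act on
`Υ^b[t] • Υ[s]{∂_b φ}` distributes the trees of `u` between `t` and `s`, exactly as `u ⋆ (t ⊙ s)`
does; an induction on trees and forests gives `elemField_star`. Both identities are then pulled back
along `Λ^*`. -/

/-- The root decoration of a tree and the forest of its branches. -/
def dest (t : Tree d) : Fin d × Forest d := QPF.Fix.dest (F := TreeF d) t

@[simp]
theorem dest_node (a : Fin d) (s : Forest d) : dest (node a s) = (a, s) :=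
  QPF.Fix.dest_mk (F := TreeF d) (a, s)

theorem node_inj {a b : Fin d} {s t : Forest d} : node a s = node b t ↔ a = b ∧ s = t := by
  refine ⟨fun h => ?_, fun ⟨h₁, h₂⟩ => by rw [h₁, h₂]⟩
  have := congrArg dest h
  rwa [dest_node, dest_node, Prod.mk.injEq] at this

theorem exists_eq_node (t : Tree d) : ∃ a s, t = node a s := by
  induction t using Tree.induction with
  | h a s _ => exact ⟨a, s, rfl⟩

/-- `Tree.fold` only takes values in `Type`, whereas `H` lives in an arbitrary universe;
well-founded recursion along this relation removes the restriction. -/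
theorem wellFounded_mem_branches : WellFounded fun t u : Tree d => t ∈ (dest u).2 := by
  refine ⟨fun t => ?_⟩
  induction t using Tree.induction with
  | h a s ih => exact ⟨_, fun u hu => ih u (by simpa using hu)⟩

/-- Structural recursion with values in an arbitrary universe. -/
theorem exists_fold {β : Type*} (g : Fin d → Multiset β → β) :
    ∃ F : Tree d → β, ∀ a s, F (node a s) = g a (s.map F) := by
  let step : ∀ t : Tree d, (∀ u, u ∈ (dest t).2 → β) → β := fun t ih =>
    g (dest t).1 ((dest t).2.attach.map fun u => ih u.1 u.2)
  refine ⟨wellFounded_mem_branches.fix step, fun a s => ?_⟩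
  rw [WellFounded.fix_eq]
  change g (dest (node a s)).1 ((dest (node a s)).2.attach.map
    fun u => wellFounded_mem_branches.fix step u.1) = _
  rw [Multiset.attach_map_val' _ (wellFounded_mem_branches.fix step), dest_node]

/-- The number of vertices of a tree. -/
def size : Tree d → ℕ := fold fun _ G => G.sum + 1

end Tree

/-- The number of vertices of a forest. -/
def Forest.size {d : ℕ} (s : Forest d) : ℕ := (s.map Tree.size).sum

theorem Tree.size_node {d : ℕ} (a : Fin d) (s : Forest d) :
    (Tree.node a s).size = Forest.size s + 1 := Tree.fold_node _ _ _

@[simp]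
theorem Forest.size_cons {d : ℕ} (t : Tree d) (s : Forest d) :
    Forest.size (t ::ₘ s) = t.size + Forest.size s := by simp [Forest.size]

/-- A nonempty forest has the form `node a r ::ₘ s` and size `size r + size s + 1`; if this is below
`N + 1`, both `r` and `s` have size below `N`. This finiteness makes `Λ^*` well defined. -/
theorem Forest.finite_size_lt (d N : ℕ) : {s : Forest d | Forest.size s < N}.Finite := by
  induction N with
  | zero => simp
  | succ N ih =>
    refine ((Set.finite_singleton (0 : Forest d)).union
      ((Set.finite_univ (α := Fin d)).image2 (fun a (p : Forest d × Forest d) =>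
        Tree.node a p.1 ::ₘ p.2) (ih.prod ih))).subset fun s hs => ?_
    induction s using Multiset.induction_on with
    | empty => exact Or.inl rfl
    | cons t s _ =>
      obtain ⟨a, r, rfl⟩ := t.exists_eq_node
      refine Or.inr ⟨a, trivial, (r, s), ?_, rfl⟩
      simp only [Set.mem_ofPred_eq, Forest.size_cons, Tree.size_node, Set.mem_prod] at hs ⊢
      omega

/-! ### The universal morphism -/

section Universal

variable {d : ℕ} {H : Type*} [CommRing H] [HopfAlgebra ℝ H]

/-- The intertwining relation dictates the value `L a (∏ F t)` on `node a s`, the product running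
over the branches; freeness of `BCK d` on trees does the rest. -/
theorem BCK.exists_algHom_bPlus (L : Fin d → H →ₗ[ℝ] H) :
    ∃ Λ : BCK d →ₐ[ℝ] H, ∀ a x, Λ (BCK.bPlus a x) = L a (Λ x) := by
  obtain ⟨F, hF⟩ := Tree.exists_fold (d := d) fun a (G : Multiset H) => L a G.prod
  refine ⟨BCK.lift F, fun a x => ?_⟩
  have : (BCK.lift F).toLinearMap ∘ₗ BCK.bPlus a = L a ∘ₗ (BCK.lift F).toLinearMap := by
    refine (BCK.basis d).ext fun s => ?_
    simp [BCK.bPlus_basis, BCK.lift_basis, hF]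
  exact LinearMap.congr_fun this x

/-- The counit vanishes on the image of a cocycle. -/
theorem counit_cocycle {L : H →ₗ[ℝ] H}
    (hL : ∀ x, (Coalgebra.comul (L x) : H ⊗[ℝ] H) =
      L.lTensor H (Coalgebra.comul x) + L x ⊗ₜ[ℝ] 1) (x : H) :
    (Coalgebra.counit (L x) : ℝ) = 0 := by
  -- Applying `id ⊗ ε` to the cocycle identity and cancelling `L x ⊗ 1` leaves `(id ⊗ ε L) Δ x = 0`.
  have h1 := Coalgebra.lTensor_counit_comul (R := ℝ) (L x)
  rw [hL, map_add, LinearMap.lTensor_tmul, Bialgebra.counit_one, add_eq_right,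
    ← LinearMap.comp_apply, ← LinearMap.lTensor_comp] at h1
  -- Applying `ε ⊗ id` then collapses `Δ x` to `x`.
  have h2 := congrArg (LinearMap.rTensor ℝ (Coalgebra.counit (R := ℝ) (A := H))) h1
  rw [← LinearMap.comp_apply, LinearMap.rTensor_comp_lTensor, ← LinearMap.lTensor_comp_rTensor,
    LinearMap.comp_apply, Coalgebra.rTensor_counit_comul] at h2
  simpa using congrArg (TensorProduct.lid ℝ ℝ) h2

/-- Compatibility with counit and coproduct is an identity of algebra morphisms, so it suffices to
pass from `x` to `B_+^a x`, where the two cocycle identities have the same shape. -/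
theorem BCK.exists_bialgHom_bPlus {L : Fin d → H →ₗ[ℝ] H}
    (hL : ∀ a x, (Coalgebra.comul (L a x) : H ⊗[ℝ] H) =
      (L a).lTensor H (Coalgebra.comul x) + L a x ⊗ₜ[ℝ] 1) :
    ∃ Λ : BCK d →ₐc[ℝ] H, ∀ a x, Λ (BCK.bPlus a x) = L a (Λ x) := by
  obtain ⟨Λ, hΛ⟩ := BCK.exists_algHom_bPlus L
  refine ⟨BialgHom.ofAlgHom Λ ?_ ?_, hΛ⟩
  · refine BCK.algHom_ext_bPlus fun a x _ => ?_
    change Coalgebra.counit (Λ (BCK.bPlus a x)) = BCK.counitHom d (BCK.bPlus a x)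
    rw [hΛ, counit_cocycle (hL a), BCK.counitHom_bPlus]
  · refine BCK.algHom_ext_bPlus fun a x hx => ?_
    change Algebra.TensorProduct.map Λ Λ (BCK.comulHom d x) = Coalgebra.comul (Λ x) at hx
    change Algebra.TensorProduct.map Λ Λ (BCK.comulHom d (BCK.bPlus a x)) =
      Coalgebra.comul (Λ (BCK.bPlus a x))
    have h1 : ∀ w : BCK d ⊗[ℝ] BCK d,
        Algebra.TensorProduct.map Λ Λ ((BCK.bPlus a).lTensor (BCK d) w) =
        (L a).lTensor H (Algebra.TensorProduct.map Λ Λ w) := by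
      intro w
      induction w with
      | zero => simp
      | add u v hu hv => simp only [map_add, hu, hv]
      | tmul u v => simp [hΛ]
    rw [BCK.comulHom_bPlus, map_add, h1, hx, hΛ, hL]
    simp [hΛ]

theorem BCK.bialgHom_ext_bPlus {L : Fin d → H →ₗ[ℝ] H} {Λ Λ' : BCK d →ₐc[ℝ] H}
    (h : ∀ a x, Λ (BCK.bPlus a x) = L a (Λ x)) (h' : ∀ a x, Λ' (BCK.bPlus a x) = L a (Λ' x)) :
    Λ' = Λ := by
  have : (Λ' : BCK d →ₐ[ℝ] H) = (Λ : BCK d →ₐ[ℝ] H) :=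
    BCK.algHom_ext_bPlus fun a x hx => by
      change Λ' x = Λ x at hx
      change Λ' _ = Λ _
      rw [h, h', hx]
  ext x
  exact DFunLike.congr_fun this x

/-- Homogeneity of `Λ`: each vertex of the forest accounts for one application of some `L a`. -/
theorem BCK.map_basis_mem (𝒜 : ℕ → Submodule ℝ H) [GradedAlgebra 𝒜] {L : Fin d → H →ₗ[ℝ] H}
    (hL : ∀ a n, ∀ x ∈ 𝒜 n, L a x ∈ 𝒜 (n + 1)) {Λ : BCK d →ₐ[ℝ] H}
    (h : ∀ a x, Λ (BCK.bPlus a x) = L a (Λ x)) (s : Forest d) :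
    Λ (BCK.basis d s) ∈ 𝒜 (Forest.size s) := by
  have key : ∀ s : Forest d, (∀ t ∈ s, Λ (BCK.basis d {t}) ∈ 𝒜 t.size) →
      Λ (BCK.basis d s) ∈ 𝒜 (Forest.size s) := by
    intro s
    induction s using Multiset.induction_on with
    | empty =>
      intro _
      rw [BCK.basis_zero, map_one]
      exact SetLike.GradedOne.one_mem
    | cons t s ih =>
      intro hs
      rw [← Multiset.singleton_add, BCK.basis_add, map_mul, Multiset.singleton_add,
        Forest.size_cons]
      exact SetLike.mul_mem_graded (hs t (Multiset.mem_cons_self t s))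
        (ih fun u hu => hs u (Multiset.mem_cons_of_mem hu))
  have tree : ∀ t : Tree d, Λ (BCK.basis d {t}) ∈ 𝒜 t.size := Tree.induction fun a s ih => by
    rw [← BCK.bPlus_basis, h, Tree.size_node]
    exact hL a _ _ (key s ih)
  exact key s fun t _ => tree t

end Universal

/-! ### Symmetry factors -/

/-- Trees outside `s` contribute `0! * S ^ 0 = 1`; a common index set lets the factors of two
forests be compared. -/
theorem Forest.symmFactor_eq_prod {d : ℕ} {s : Forest d} {T : Finset (Tree d)}
    (h : s.toFinset ⊆ T) :
    Forest.symmFactor s = ∏ t ∈ T, (s.count t).factorial * t.symmFactor ^ s.count t := by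
  refine Finset.prod_subset h fun t _ ht => ?_
  rw [Multiset.mem_toFinset] at ht
  simp [Multiset.count_eq_zero_of_notMem ht]

theorem Forest.symmFactor_zero {d : ℕ} : Forest.symmFactor (0 : Forest d) = 1 := by
  simp [Forest.symmFactor]

/-- Only the factor of `t` changes, from `k! S(t)^k` to `(k+1)! S(t)^(k+1)`. This recursion is what
makes the normalised pairing a duality. -/
theorem Forest.symmFactor_cons {d : ℕ} (t : Tree d) (s : Forest d) :
    Forest.symmFactor (t ::ₘ s) = (s.count t + 1) * t.symmFactor * Forest.symmFactor s := by
  have h1 : (t ::ₘ s).toFinset ⊆ insert t s.toFinset := by simp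
  rw [Forest.symmFactor_eq_prod h1, Forest.symmFactor_eq_prod (Finset.subset_insert t s.toFinset),
    ← Finset.mul_prod_erase _ _ (Finset.mem_insert_self t _),
    ← Finset.mul_prod_erase (insert t s.toFinset) _ (Finset.mem_insert_self t _),
    Finset.prod_congr rfl fun u hu => by
      rw [Multiset.count_cons_of_ne (Finset.ne_of_mem_erase hu)],
    Multiset.count_cons_self, Nat.factorial_succ, pow_succ]
  ring

theorem Forest.symmFactor_singleton {d : ℕ} (t : Tree d) :
    Forest.symmFactor ({t} : Forest d) = t.symmFactor := by
  rw [← Multiset.cons_zero, Forest.symmFactor_cons, Forest.symmFactor_zero]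
  simp

theorem Tree.symmFactor_node {d : ℕ} (a : Fin d) (s : Forest d) :
    (Tree.node a s).symmFactor = Forest.symmFactor s := by
  classical
  have hinj : Function.Injective fun t : Tree d => (t, t.symmFactor) :=
    fun t u h => congrArg Prod.fst h
  rw [Tree.symmFactor, Tree.para_node, Forest.symmFactor]
  change ∏ p ∈ (s.map fun t => (t, t.symmFactor)).toFinset, _ = _
  rw [Multiset.toFinset_map, Finset.prod_image hinj.injOn]
  refine Finset.prod_congr (by congr) fun t _ => ?_
  -- The definition of the symmetry factor hides a classical decidability instance, so the count is
  -- computed for every instance.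
  have h : ∀ inst : DecidableEq (Tree d × ℕ),
      @Multiset.count _ inst (t, t.symmFactor) (s.map fun t => (t, t.symmFactor)) = s.count t := by
    intro inst
    convert Multiset.count_map_eq_count' (fun t : Tree d => (t, t.symmFactor)) s hinj t
  exact congrArg (fun n : ℕ => n.factorial * t.symmFactor ^ n) (h _)

theorem Forest.symmFactor_ne_zero {d : ℕ} (s : Forest d) : Forest.symmFactor s ≠ 0 := by
  have key : ∀ s : Forest d, (∀ t ∈ s, t.symmFactor ≠ 0) → Forest.symmFactor s ≠ 0 :=
    fun s hs => Finset.prod_ne_zero_iff.2 fun t ht =>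
      mul_ne_zero (Nat.factorial_ne_zero _) (pow_ne_zero _ (hs t (Multiset.mem_toFinset.1 ht)))
  have tree : ∀ t : Tree d, t.symmFactor ≠ 0 := Tree.induction fun a s ih => by
    rw [Tree.symmFactor_node]
    exact key s ih
  exact key s fun t _ => tree t

/-! ### Convolution algebras -/

section Convolution

variable {C C' A A' : Type*} [AddCommGroup C] [Module ℝ C] [Coalgebra ℝ C]
  [AddCommGroup C'] [Module ℝ C'] [Coalgebra ℝ C']
  [Ring A] [Algebra ℝ A] [Ring A'] [Algebra ℝ A']

/-- Composition with an algebra morphism, as a morphism of convolution algebras. -/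
def convMap (h : A →ₐ[ℝ] A') : WithConv (C →ₗ[ℝ] A) →ₐ[ℝ] WithConv (C →ₗ[ℝ] A') :=
  AlgHom.ofLinearMap
    ((WithConv.linearEquiv ℝ (C →ₗ[ℝ] A')).symm.toLinearMap ∘ₗ
      LinearMap.compRight ℝ h.toLinearMap ∘ₗ (WithConv.linearEquiv ℝ (C →ₗ[ℝ] A)).toLinearMap)
    (WithConv.ext (LinearMap.ext fun _ => h.commutes _))
    fun f g => WithConv.ext (LinearMap.algHom_comp_convMul_distrib h f g)

/-- Composition with a coalgebra morphism, as a morphism of convolution algebras. -/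
def convComap (h : C →ₗc[ℝ] C') : WithConv (C' →ₗ[ℝ] A) →ₐ[ℝ] WithConv (C →ₗ[ℝ] A) :=
  AlgHom.ofLinearMap
    ((WithConv.linearEquiv ℝ (C →ₗ[ℝ] A)).symm.toLinearMap ∘ₗ
      LinearMap.lcomp ℝ A h.toLinearMap ∘ₗ (WithConv.linearEquiv ℝ (C' →ₗ[ℝ] A)).toLinearMap)
    (WithConv.ext (LinearMap.ext fun c => by
      change algebraMap ℝ A (Coalgebra.counit (h c)) = algebraMap ℝ A (Coalgebra.counit c)
      rw [CoalgHomClass.counit_comp_apply]))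
    fun f g => WithConv.ext (LinearMap.convMul_comp_coalgHom_distrib f g h)

end Convolution

/-! ### Duality of the forest product and the unshuffle coproduct -/

namespace BCKDual

variable {d : ℕ}

theorem basis_zero : basis d 0 = 1 := rfl

theorem basis_add (s t : Forest d) : basis d (s + t) = basis d s * basis d t := BCK.basis_add s t

theorem basis_cons (t : Tree d) (s : Forest d) :
    basis d (t ::ₘ s) = basis d {t} * basis d s := by
  rw [← basis_add, Multiset.singleton_add]

/-- The algebra morphism for `⊙` with prescribed values on trees. -/
def lift {A : Type*} [CommRing A] [Algebra ℝ A] (g : Tree d → A) : BCKDual d →ₐ[ℝ] A := BCK.lift g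

theorem lift_basis {A : Type*} [CommRing A] [Algebra ℝ A] (g : Tree d → A) (s : Forest d) :
    lift g (basis d s) = (s.map g).prod := BCK.lift_basis g s

theorem lift_basis_singleton {A : Type*} [CommRing A] [Algebra ℝ A] (g : Tree d → A) (t : Tree d) :
    lift g (basis d {t}) = g t := by rw [lift_basis]; simp

theorem bPlus_basis (a : Fin d) (s : Forest d) :
    bPlus a (basis d s) = basis d {Tree.node a s} := (basis d).constr_basis _ _ _

theorem comul_mul (u v : BCKDual d) :
    (Coalgebra.comul (u * v) : BCKDual d ⊗[ℝ] BCKDual d) = Coalgebra.comul u * Coalgebra.comul v :=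
  map_mul (comulHom d) u v

theorem comul_basis_singleton (t : Tree d) :
    (Coalgebra.comul (basis d {t}) : BCKDual d ⊗[ℝ] BCKDual d) =
      basis d {t} ⊗ₜ[ℝ] 1 + 1 ⊗ₜ[ℝ] basis d {t} := comulHom_basis_singleton t

theorem counit_basis (s : Forest d) :
    (Coalgebra.counit (basis d s) : ℝ) = if s = 0 then 1 else 0 := by
  change lift (fun _ => (0 : ℝ)) (basis d s) = _
  rw [lift_basis]
  induction s using Multiset.induction_on with
  | empty => simp
  | cons t s _ => simp

theorem pairing_basis (s t : Forest d) :
    pairing d (basis d s) (BCK.basis d t) = if s = t then (Forest.symmFactor t : ℝ) else 0 := by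
  rw [pairing, Module.Basis.constr_basis, Module.Basis.constr_basis]

theorem pairing_basis_right (u : BCKDual d) (t : Forest d) :
    pairing d u (BCK.basis d t) = (basis d).repr u t * Forest.symmFactor t := by
  have : (pairing d).flip (BCK.basis d t) =
      (Forest.symmFactor t : ℝ) • (basis d).coord t := by
    refine (basis d).ext fun s => ?_
    simp [pairing_basis, Finsupp.single_apply]
  have := LinearMap.congr_fun this u
  simpa [mul_comm] using this

theorem ext_pairing {u v : BCKDual d} (h : ∀ x, pairing d u x = pairing d v x) : u = v := by
  refine (basis d).repr.injective (Finsupp.ext fun s => ?_)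
  have := h (BCK.basis d s)
  rw [pairing_basis_right, pairing_basis_right] at this
  exact mul_right_cancel₀ (Nat.cast_ne_zero.2 (Forest.symmFactor_ne_zero s)) this

theorem pairing_one (u : BCKDual d) : pairing d u 1 = Coalgebra.counit u := by
  have : (pairing d).flip 1 = Coalgebra.counit := by
    refine (basis d).ext fun s => ?_
    rw [LinearMap.flip_apply, ← BCK.basis_zero, pairing_basis, counit_basis,
      Forest.symmFactor_zero, Nat.cast_one]
  exact LinearMap.congr_fun this u

theorem one_pairing (x : BCK d) : pairing d 1 x = Coalgebra.counit x := by
  have : pairing d 1 = (BCK.counitHom d).toLinearMap := by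
    refine (BCK.basis d).ext fun s => ?_
    rw [← basis_zero, pairing_basis, AlgHom.toLinearMap_apply, BCK.counitHom, BCK.lift_basis]
    induction s using Multiset.induction_on with
    | empty => simp [Forest.symmFactor_zero]
    | cons t s _ => simp
  exact LinearMap.congr_fun this x

/-! ### Derivations adjoint to multiplication by a tree -/

/-- The derivation `∂/∂t` of the polynomial algebra in the trees. -/
def treeDeriv (t : Tree d) : BCKDual d →ₗ[ℝ] BCKDual d :=
  (basis d).constr ℝ fun s => (s.count t : ℝ) • basis d (s.erase t)

theorem treeDeriv_basis (t : Tree d) (s : Forest d) :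
    treeDeriv t (basis d s) = (s.count t : ℝ) • basis d (s.erase t) :=
  (basis d).constr_basis _ _ _

theorem treeDeriv_one (t : Tree d) : treeDeriv t (1 : BCKDual d) = 0 := by
  rw [← basis_zero, treeDeriv_basis]
  simp

theorem treeDeriv_tree_mul (t u : Tree d) (w : BCKDual d) :
    treeDeriv t (basis d {u} * w) =
      (if t = u then (1 : ℝ) else 0) • w + basis d {u} * treeDeriv t w := by
  have : treeDeriv t ∘ₗ LinearMap.mulLeft ℝ (basis d {u}) =
      (if t = u then (1 : ℝ) else 0) • LinearMap.id +
        LinearMap.mulLeft ℝ (basis d {u}) ∘ₗ treeDeriv t := by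
    refine (basis d).ext fun s => ?_
    simp only [LinearMap.comp_apply, LinearMap.mulLeft_apply, LinearMap.add_apply,
      LinearMap.smul_apply, LinearMap.id_apply]
    rw [← basis_cons, treeDeriv_basis, treeDeriv_basis, mul_smul_comm, ← basis_cons]
    by_cases h : t = u
    · subst h
      by_cases hs : t ∈ s
      · simp [Multiset.cons_erase hs, add_smul, add_comm]
      · simp [Multiset.count_eq_zero_of_notMem hs]
    · simp [h, Multiset.erase_cons_tail s (Ne.symm h), Multiset.count_cons_of_ne h]
  exact LinearMap.congr_fun this w

/-- The coproduct substitutes `t ⊗ 1 + 1 ⊗ t` for each tree, as in `f(x + y)`, and the derivative of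
`f(x + y)` may be taken in `x` alone. Formally, both sides obey the same rule when multiplied by a
generator. -/
theorem comul_treeDeriv (t : Tree d) (u : BCKDual d) :
    (Coalgebra.comul (treeDeriv t u) : BCKDual d ⊗[ℝ] BCKDual d) =
      (treeDeriv t).rTensor (BCKDual d) (Coalgebra.comul u) := by
  have h1 : ∀ (r : Tree d) (w : BCKDual d ⊗[ℝ] BCKDual d),
      (treeDeriv t).rTensor (BCKDual d) ((basis d {r} ⊗ₜ[ℝ] 1 + 1 ⊗ₜ[ℝ] basis d {r}) * w) =
      (if t = r then (1 : ℝ) else 0) • w + (basis d {r} ⊗ₜ[ℝ] 1 + 1 ⊗ₜ[ℝ] basis d {r}) *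
        (treeDeriv t).rTensor (BCKDual d) w := by
    intro r w
    induction w with
    | zero => simp
    | add p q hp hq => simp only [mul_add, map_add, hp, hq, smul_add]; abel
    | tmul p q =>
      simp only [add_mul, map_add, Algebra.TensorProduct.tmul_mul_tmul, one_mul,
        LinearMap.rTensor_tmul, treeDeriv_tree_mul, TensorProduct.add_tmul,
        ← TensorProduct.smul_tmul']
      abel
  have : Coalgebra.comul ∘ₗ treeDeriv t =
      (treeDeriv t).rTensor (BCKDual d) ∘ₗ Coalgebra.comul := by
    refine (basis d).ext fun s => ?_
    simp only [LinearMap.comp_apply]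
    induction s using Multiset.induction_on with
    | empty => simp [basis_zero, treeDeriv_one, Bialgebra.comul_one, Algebra.TensorProduct.one_def]
    | cons r s ih =>
      rw [basis_cons, treeDeriv_tree_mul, map_add, map_smul, comul_mul, ih, comul_mul,
        comul_basis_singleton, h1]
  exact LinearMap.congr_fun this u

/-- The multiplicity produced by the derivation is the factor `count + 1` in
`Forest.symmFactor_cons`, and `S(t)` is what remains. -/
theorem pairing_tree_mul (u : BCKDual d) (t : Tree d) (x : BCK d) :
    pairing d u (BCK.basis d {t} * x) = t.symmFactor * pairing d (treeDeriv t u) x := by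
  have : ((pairing d).compl₂ (LinearMap.mulLeft ℝ (BCK.basis d {t}))) =
      (t.symmFactor : ℝ) • (pairing d ∘ₗ treeDeriv t) := by
    refine (basis d).ext fun s => (BCK.basis d).ext fun r => ?_
    simp only [LinearMap.compl₂_apply, LinearMap.mulLeft_apply, LinearMap.smul_apply,
      LinearMap.comp_apply, treeDeriv_basis, map_smul, smul_eq_mul]
    rw [← BCK.basis_add, pairing_basis, pairing_basis, Multiset.singleton_add]
    by_cases hs : t ∈ s
    · obtain ⟨s, rfl⟩ := Multiset.exists_cons_of_mem hs
      simp only [Multiset.cons_inj_right, Multiset.erase_cons_head]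
      split_ifs with h
      · subst h
        rw [Forest.symmFactor_cons, Multiset.count_cons_self]
        push_cast
        ring
      · simp
    · rw [Multiset.count_eq_zero_of_notMem hs, if_neg]
      · simp
      · rintro rfl
        exact hs (Multiset.mem_cons_self t r)
  exact LinearMap.congr_fun₂ this u x

/-- The unshuffle coproduct is dual to the forest product. -/
theorem pairing_mul (u : BCKDual d) (x y : BCK d) :
    pairing d u (x * y) = LinearMap.mul' ℝ ℝ
      (TensorProduct.map ((pairing d).flip x) ((pairing d).flip y) (Coalgebra.comul u)) := by
  -- The vector `u` is universally quantified because removing a tree from `s` replaces `u` by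
  -- `treeDeriv t u`.
  have key : ∀ (s : Forest d) (u : BCKDual d), pairing d u (BCK.basis d s * y) =
      LinearMap.mul' ℝ ℝ (TensorProduct.map ((pairing d).flip (BCK.basis d s))
        ((pairing d).flip y) (Coalgebra.comul u)) := by
    intro s
    induction s using Multiset.induction_on with
    | empty =>
      intro u
      have h : (pairing d).flip (BCK.basis d 0) = Coalgebra.counit :=
        LinearMap.ext fun v => pairing_one v
      rw [h, ← LinearMap.lTensor_comp_rTensor, LinearMap.comp_apply,
        Coalgebra.rTensor_counit_comul]
      simp [BCK.basis_zero]
    | cons t s ih =>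
      intro u
      have h : (pairing d).flip (BCK.basis d (t ::ₘ s)) =
          (t.symmFactor : ℝ) • ((pairing d).flip (BCK.basis d s) ∘ₗ treeDeriv t) := by
        refine LinearMap.ext fun v => ?_
        rw [← Multiset.singleton_add, BCK.basis_add]
        exact pairing_tree_mul v t _
      rw [h, ← Multiset.singleton_add, BCK.basis_add, mul_assoc, pairing_tree_mul, ih,
        comul_treeDeriv, TensorProduct.map_smul_left, LinearMap.smul_apply, map_smul,
        ← LinearMap.comp_apply (TensorProduct.map _ _), LinearMap.map_comp_rTensor]
      rfl
  have : pairing d u ∘ₗ (LinearMap.mul ℝ (BCK d)).flip y =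
      LinearMap.mul' ℝ ℝ ∘ₗ (LinearMap.applyₗ (Coalgebra.comul u)) ∘ₗ
        ((TensorProduct.mapBilinear (.id ℝ) (BCKDual d) (BCKDual d) ℝ ℝ).flip
          ((pairing d).flip y) ∘ₗ (pairing d).flip) :=
    (BCK.basis d).ext fun s => key s u
  exact LinearMap.congr_fun this x

/-- The pairing as a morphism from the forest algebra to the convolution algebra of the unshuffle
coproduct. -/
def pairingHom (d : ℕ) : BCK d →ₐ[ℝ] WithConv (BCKDual d →ₗ[ℝ] ℝ) :=
  AlgHom.ofLinearMap
    ((WithConv.linearEquiv ℝ (BCKDual d →ₗ[ℝ] ℝ)).symm.toLinearMap ∘ₗ (pairing d).flip)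
    (WithConv.ext (LinearMap.ext pairing_one))
    fun x y => WithConv.ext (LinearMap.ext fun u => pairing_mul u x y)

/-! ### The Grossman-Larson product is dual to the Butcher-Connes-Kreimer coproduct -/

/-- The linear map with prescribed values on trees, vanishing on all other forests. -/
def treeLift {M : Type*} [AddCommGroup M] [Module ℝ M] (g : Tree d → M) : BCKDual d →ₗ[ℝ] M :=
  (basis d).constr ℝ fun s => if Multiset.card s = 1 then (s.map g).sum else 0

section TreeLift

variable {M : Type*} [AddCommGroup M] [Module ℝ M] (g : Tree d → M)

theorem treeLift_basis (s : Forest d) :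
    treeLift g (basis d s) = if Multiset.card s = 1 then (s.map g).sum else 0 :=
  (basis d).constr_basis _ _ _

@[simp]
theorem treeLift_basis_singleton (t : Tree d) : treeLift g (basis d {t}) = g t := by
  simp [treeLift_basis]

@[simp]
theorem treeLift_one : treeLift g 1 = 0 := by
  rw [← basis_zero, treeLift_basis]
  simp

/-- A product of two nonempty forests is never a single tree, so `treeLift g` is a derivation over
the counit. -/
theorem treeLift_mul (u v : BCKDual d) :
    treeLift g (u * v) = (Coalgebra.counit u : ℝ) • treeLift g v +
      (Coalgebra.counit v : ℝ) • treeLift g u := by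
  have : (LinearMap.mul ℝ (BCKDual d)).compr₂ (treeLift g) =
      (LinearMap.lsmul ℝ M).compl₁₂ (Coalgebra.counit : BCKDual d →ₗ[ℝ] ℝ) (treeLift g) +
      ((LinearMap.lsmul ℝ M).compl₁₂ (Coalgebra.counit : BCKDual d →ₗ[ℝ] ℝ) (treeLift g)).flip := by
    refine (basis d).ext fun s => (basis d).ext fun t => ?_
    simp only [LinearMap.compr₂_apply, LinearMap.mul_apply', LinearMap.add_apply,
      LinearMap.compl₁₂_apply, LinearMap.lsmul_apply, LinearMap.flip_apply]
    rcases eq_or_ne s 0 with rfl | hs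
    · rcases eq_or_ne t 0 with rfl | ht
      · simp [basis_zero]
      · rw [counit_basis t, if_neg ht]
        simp [basis_zero]
    · rcases eq_or_ne t 0 with rfl | ht
      · rw [counit_basis s, if_neg hs]
        simp [basis_zero]
      · have h1 := Multiset.card_pos.2 hs
        have h2 := Multiset.card_pos.2 ht
        rw [counit_basis, counit_basis, if_neg hs, if_neg ht, ← basis_add, treeLift_basis,
          if_neg (by rw [Multiset.card_add]; omega)]
        simp
  exact LinearMap.congr_fun₂ this u v

/-- In a convolution product a single tree can only arise when one of the two factors contributes
the empty forest. -/
theorem treeLift_convMul (A B : WithConv (BCKDual d →ₗ[ℝ] BCKDual d)) (u : BCKDual d) :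
    treeLift g ((A * B) u) =
      TensorProduct.lid ℝ M (TensorProduct.map (Coalgebra.counit ∘ₗ A.ofConv)
        (treeLift g ∘ₗ B.ofConv) (Coalgebra.comul u)) +
      TensorProduct.rid ℝ M (TensorProduct.map (treeLift g ∘ₗ A.ofConv)
        (Coalgebra.counit ∘ₗ B.ofConv) (Coalgebra.comul u)) := by
  rw [LinearMap.convMul_apply]
  generalize (Coalgebra.comul u : BCKDual d ⊗[ℝ] BCKDual d) = w
  induction w with
  | zero => simp
  | add p q hp hq => simp only [map_add, hp, hq]; abel
  | tmul p q => simp [treeLift_mul]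

end TreeLift

/-- Grafting as a morphism from the forest algebra to the convolution algebra. -/
def graftHom (d : ℕ) : BCKDual d →ₐ[ℝ] WithConv (BCKDual d →ₗ[ℝ] BCKDual d) := lift graftTree

theorem graftHom_basis_singleton (t : Tree d) : graftHom d (basis d {t}) = graftTree t :=
  lift_basis_singleton _ _

/-- Together with the multiplicativity of `graftHom`, this form reduces computations with `⋆` to
algebra in the convolution algebra. -/
theorem star_eq_convMul (u v : BCKDual d) :
    star d u v = (WithConv.toConv LinearMap.id * graftHom d v).ofConv u := by
  have : (star d).flip v = (WithConv.toConv LinearMap.id * graftHom d v).ofConv := by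
    have h : (star d).flip = (WithConv.linearEquiv ℝ _).toLinearMap ∘ₗ
        LinearMap.mulLeft ℝ (WithConv.toConv (LinearMap.id : BCKDual d →ₗ[ℝ] BCKDual d)) ∘ₗ
          (graftHom d).toLinearMap := by
      refine (basis d).ext fun s => ?_
      simp only [LinearMap.comp_apply, AlgHom.toLinearMap_apply, LinearMap.mulLeft_apply]
      rw [star, LinearMap.flip_flip, Module.Basis.constr_basis, graftHom, lift_basis]
      rfl
    exact LinearMap.congr_fun h v
  exact LinearMap.congr_fun this u

/-- Below the new root, trees of `u` attached to the root stay separate while the others are grafted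
onto branches, which is the product `u ⋆ s`. -/
theorem graftTree_node (a : Fin d) (s : Forest d) (u : BCKDual d) :
    graftTree (Tree.node a s) u = bPlus a (star d u (basis d s)) := by
  rw [star_eq_convMul, graftHom, lift_basis, graftTree, Tree.fold_node]
  rfl

theorem counit_bPlus (a : Fin d) (u : BCKDual d) : (Coalgebra.counit (bPlus a u) : ℝ) = 0 := by
  have : Coalgebra.counit ∘ₗ bPlus a = (0 : BCKDual d →ₗ[ℝ] ℝ) := by
    refine (basis d).ext fun s => ?_
    rw [LinearMap.comp_apply, bPlus_basis, counit_basis]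
    simp
  exact LinearMap.congr_fun this u

theorem counit_graftTree (t : Tree d) (u : BCKDual d) :
    (Coalgebra.counit (graftTree t u) : ℝ) = 0 := by
  obtain ⟨a, s, rfl⟩ := t.exists_eq_node
  rw [graftTree_node, counit_bPlus]

/-- Both sides are algebra morphisms in `v`, and both vanish when `v` is a tree, since grafting onto
a tree yields trees. -/
theorem counit_graftHom (u v : BCKDual d) :
    (Coalgebra.counit (graftHom d v u) : ℝ) = Coalgebra.counit v * Coalgebra.counit u := by
  have : (convMap (counitHom d)).comp (graftHom d) =
      (Algebra.ofId ℝ (WithConv (BCKDual d →ₗ[ℝ] ℝ))).comp (counitHom d) := by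
    refine algHom_ext fun t => ?_
    simp only [AlgHom.comp_apply, graftHom_basis_singleton, counitHom_basis_singleton, map_zero]
    exact WithConv.ext (LinearMap.ext fun u => counit_graftTree t u)
  exact LinearMap.congr_fun (congrArg WithConv.ofConv (DFunLike.congr_fun this v)) u

theorem comul_bPlus (a : Fin d) (u : BCKDual d) :
    (Coalgebra.comul (bPlus a u) : BCKDual d ⊗[ℝ] BCKDual d) =
      bPlus a u ⊗ₜ[ℝ] 1 + 1 ⊗ₜ[ℝ] bPlus a u := by
  have : Coalgebra.comul ∘ₗ bPlus a =
      (TensorProduct.mk ℝ (BCKDual d) (BCKDual d)).flip 1 ∘ₗ bPlus a +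
        TensorProduct.mk ℝ (BCKDual d) (BCKDual d) 1 ∘ₗ bPlus a := by
    refine (basis d).ext fun s => ?_
    simp [bPlus_basis, comul_basis_singleton]
  exact LinearMap.congr_fun this u

theorem comul_graftTree (t : Tree d) (u : BCKDual d) :
    (Coalgebra.comul (graftTree t u) : BCKDual d ⊗[ℝ] BCKDual d) =
      graftTree t u ⊗ₜ[ℝ] 1 + 1 ⊗ₜ[ℝ] graftTree t u := by
  obtain ⟨a, s, rfl⟩ := t.exists_eq_node
  rw [graftTree_node, comul_bPlus]

/-! ### Removing roots: the transpose of the cocycle identity -/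

/-- The adjoint of `B_+^a`, removing the root of a tree whose root is decorated by `a`. -/
def bMinus (a : Fin d) : BCKDual d →ₗ[ℝ] BCKDual d :=
  treeLift fun t => if t.dest.1 = a then basis d t.dest.2 else 0

theorem bMinus_tree (a b : Fin d) (s : Forest d) :
    bMinus a (basis d {Tree.node b s}) = if b = a then basis d s else 0 := by
  rw [bMinus, treeLift_basis_singleton, Tree.dest_node]

theorem bMinus_bPlus (a b : Fin d) (u : BCKDual d) :
    bMinus a (bPlus b u) = if b = a then u else 0 := by
  have : bMinus a ∘ₗ bPlus b = if b = a then LinearMap.id else (0 : BCKDual d →ₗ[ℝ] BCKDual d) := by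
    refine (basis d).ext fun s => ?_
    rw [LinearMap.comp_apply, bPlus_basis, bMinus_tree]
    split_ifs <;> simp
  have := LinearMap.congr_fun this u
  rw [LinearMap.comp_apply] at this
  rw [this]
  split_ifs <;> simp

/-- Adjointness without any extra factor expresses `S(B_+^a s) = S(s)`. -/
theorem pairing_bPlus (a : Fin d) (u : BCKDual d) (x : BCK d) :
    pairing d u (BCK.bPlus a x) = pairing d (bMinus a u) x := by
  have : (pairing d).compl₂ (BCK.bPlus a) = pairing d ∘ₗ bMinus a := by
    refine (basis d).ext fun s => (BCK.basis d).ext fun r => ?_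
    rw [LinearMap.compl₂_apply, LinearMap.comp_apply, BCK.bPlus_basis, pairing_basis,
      Forest.symmFactor_singleton, Tree.symmFactor_node]
    by_cases hs : Multiset.card s = 1
    · obtain ⟨t, rfl⟩ := Multiset.card_eq_one.1 hs
      obtain ⟨b, s, rfl⟩ := t.exists_eq_node
      rw [bMinus_tree]
      simp only [Multiset.singleton_inj, Tree.node_inj]
      by_cases h : b = a
      · rw [if_pos h, pairing_basis]
        simp [h]
      · simp [h]
    · rw [if_neg (by rintro rfl; simp at hs), bMinus, treeLift_basis, if_neg hs]
      simp
  exact LinearMap.congr_fun₂ this u x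

/-- For a tree `v` this is `graftTree_node`. For every other forest both sides vanish: grafting onto
the empty forest leaves a multiple of `1`, and grafting onto two or more trees never produces a
single tree. -/
theorem bMinus_graftHom (a : Fin d) (u v : BCKDual d) :
    bMinus a (graftHom d v u) = star d u (bMinus a v) := by
  have : ((WithConv.linearEquiv ℝ (BCKDual d →ₗ[ℝ] BCKDual d)).toLinearMap ∘ₗ
        (graftHom d).toLinearMap).compr₂ (bMinus a) = (star d).flip ∘ₗ bMinus a := by
    refine (basis d).ext fun s => LinearMap.ext fun u => ?_
    change bMinus a (graftHom d (basis d s) u) = star d u (bMinus a (basis d s))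
    induction s using Multiset.induction_on with
    | empty =>
      rw [basis_zero, map_one, LinearMap.convOne_apply, Algebra.algebraMap_eq_smul_one, map_smul,
        bMinus, treeLift_one]
      simp
    | cons t s _ =>
      rcases eq_or_ne s 0 with rfl | hs
      · obtain ⟨b, s, rfl⟩ := t.exists_eq_node
        rw [Multiset.cons_zero, graftHom_basis_singleton, graftTree_node, bMinus_bPlus,
          bMinus_tree]
        split_ifs <;> simp
      · have h1 : Coalgebra.counit ∘ₗ (graftHom d (basis d {t})).ofConv =
            (0 : BCKDual d →ₗ[ℝ] ℝ) :=
          LinearMap.ext fun u => by simp [counit_graftHom, counit_basis]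
        have h2 : Coalgebra.counit ∘ₗ (graftHom d (basis d s)).ofConv =
            (0 : BCKDual d →ₗ[ℝ] ℝ) :=
          LinearMap.ext fun u => by simp [counit_graftHom, counit_basis, hs]
        have h3 : bMinus a (basis d (t ::ₘ s)) = 0 := by
          rw [bMinus, treeLift_basis, if_neg]
          simpa using hs
        rw [h3, map_zero, basis_cons, map_mul, bMinus, treeLift_convMul, h1, h2]
        simp
  exact LinearMap.congr_fun₂ this v u

/-- A single tree in `u ⋆ v` comes either from grafting all of `u` onto `v`, or from `u` itself when
`v` is empty. The two terms are the transposes of `(id ⊗ B_+^a) Δ` and `B_+^a ⊗ 1`. -/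
theorem bMinus_star (a : Fin d) (u v : BCKDual d) :
    bMinus a (star d u v) =
      star d u (bMinus a v) + (Coalgebra.counit v : ℝ) • bMinus a u := by
  have h1 : Coalgebra.counit ∘ₗ (graftHom d v).ofConv =
      (Coalgebra.counit v : ℝ) • (Coalgebra.counit : BCKDual d →ₗ[ℝ] ℝ) :=
    LinearMap.ext fun u => counit_graftHom u v
  rw [star_eq_convMul, ← bMinus_graftHom, bMinus, treeLift_convMul, h1]
  simp only [LinearMap.comp_id]
  rw [← LinearMap.lTensor_comp_rTensor, LinearMap.comp_apply, Coalgebra.rTensor_counit_comul,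
    TensorProduct.map_smul_right, LinearMap.smul_apply, ← LinearMap.rTensor_comp_lTensor,
    LinearMap.comp_apply, Coalgebra.lTensor_counit_comul]
  simp

/-! ### Compatibility of `⋆` with the unshuffle coproduct, and duality -/

/-- The product `⋆` as a map on the tensor square. -/
def starTensor (d : ℕ) : BCKDual d ⊗[ℝ] BCKDual d →ₗ[ℝ] BCKDual d := TensorProduct.lift (star d)

/-- Writing `(A ⊗ B) Δ` as a convolution product with values in the tensor square makes ring
identities available. -/
theorem convMul_includeLeft_includeRight (A B : WithConv (BCKDual d →ₗ[ℝ] BCKDual d))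
    (u : BCKDual d) :
    (convMap (A' := BCKDual d ⊗[ℝ] BCKDual d) Algebra.TensorProduct.includeLeft A *
      convMap Algebra.TensorProduct.includeRight B).ofConv u =
      TensorProduct.map A.ofConv B.ofConv (Coalgebra.comul u) := by
  rw [LinearMap.convMul_apply]
  generalize (Coalgebra.comul u : BCKDual d ⊗[ℝ] BCKDual d) = w
  induction w with
  | zero => simp
  | add p q hp hq => simp only [map_add, hp, hq]
  | tmul p q => simp [convMap]

/-- Both sides are algebra morphisms in `v`; on a tree the claim is that grafting produces primitive
elements. -/
theorem comul_graftHom (v : BCKDual d) :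
    convMap (comulHom d) (graftHom d v) =
      Algebra.TensorProduct.productMap
        ((convMap Algebra.TensorProduct.includeLeft).comp (graftHom d))
        ((convMap Algebra.TensorProduct.includeRight).comp (graftHom d)) (comulHom d v) := by
  have : (convMap (comulHom d)).comp (graftHom d) =
      (Algebra.TensorProduct.productMap
        ((convMap Algebra.TensorProduct.includeLeft).comp (graftHom d))
        ((convMap Algebra.TensorProduct.includeRight).comp (graftHom d))).comp (comulHom d) := by
    refine algHom_ext fun t => ?_
    simp only [AlgHom.comp_apply, comulHom_basis_singleton, map_add,
      Algebra.TensorProduct.productMap_apply_tmul, map_one, mul_one, one_mul,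
      graftHom_basis_singleton]
    exact WithConv.ext (LinearMap.ext fun u => comul_graftTree t u)
  exact DFunLike.congr_fun this v

theorem comul_star (u v : BCKDual d) :
    (Coalgebra.comul (star d u v) : BCKDual d ⊗[ℝ] BCKDual d) =
      TensorProduct.map (starTensor d) (starTensor d)
        (TensorProduct.tensorTensorTensorComm ℝ (BCKDual d) (BCKDual d) (BCKDual d) (BCKDual d)
          (Coalgebra.comul u ⊗ₜ[ℝ] Coalgebra.comul v)) := by
  have h0 : convMap (comulHom d) (WithConv.toConv LinearMap.id) =
      convMap Algebra.TensorProduct.includeLeft (WithConv.toConv LinearMap.id) *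
        convMap Algebra.TensorProduct.includeRight (WithConv.toConv LinearMap.id) := by
    refine WithConv.ext (LinearMap.ext fun u => ?_)
    rw [convMul_includeLeft_includeRight]
    simp only [TensorProduct.map_id]
    rfl
  have h1 : Coalgebra.comul (star d u v) =
      convMap (comulHom d) (WithConv.toConv LinearMap.id * graftHom d v) u := by
    rw [star_eq_convMul]
    rfl
  rw [h1, map_mul, comul_graftHom, h0]
  change _ = TensorProduct.map (starTensor d) (starTensor d)
        (TensorProduct.tensorTensorTensorComm ℝ (BCKDual d) (BCKDual d) (BCKDual d) (BCKDual d)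
          (Coalgebra.comul u ⊗ₜ[ℝ] comulHom d v))
  generalize comulHom d v = w
  induction w with
  | zero => simp
  | add p q hp hq =>
    rw [TensorProduct.tmul_add, map_add, map_add, map_add, ← hp, ← hq, mul_add]
    rfl
  | tmul p q =>
    -- Exchanging the two middle factors needs a commutative convolution algebra, which
    -- cocommutativity of the unshuffle coproduct provides.
    rw [Algebra.TensorProduct.productMap_apply_tmul, AlgHom.comp_apply, AlgHom.comp_apply,
      mul_mul_mul_comm, ← map_mul, ← map_mul, convMul_includeLeft_includeRight]
    generalize (Coalgebra.comul u : BCKDual d ⊗[ℝ] BCKDual d) = z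
    induction z with
    | zero => simp
    | add x y hx hy => simp only [map_add, hx, hy, TensorProduct.add_tmul]
    | tmul x y => simp [starTensor, star_eq_convMul]

theorem counit_star (u v : BCKDual d) :
    (Coalgebra.counit (star d u v) : ℝ) = Coalgebra.counit u * Coalgebra.counit v := by
  have h : (Coalgebra.counit (star d u v) : ℝ) =
      (convMap (counitHom d) (WithConv.toConv LinearMap.id * graftHom d v)).ofConv u := by
    rw [star_eq_convMul]
    rfl
  have h0 : convMap (counitHom d) (WithConv.toConv LinearMap.id) =
      (1 : WithConv (BCKDual d →ₗ[ℝ] ℝ)) := rfl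
  rw [h, map_mul, h0, one_mul, mul_comm]
  exact counit_graftHom u v

/-- The product `⋆` is a morphism of coalgebras. -/
def starCoalgHom (d : ℕ) : BCKDual d ⊗[ℝ] BCKDual d →ₗc[ℝ] BCKDual d where
  toLinearMap := starTensor d
  counit_comp := TensorProduct.ext' fun u v => (counit_star u v).trans (mul_comm _ _)
  map_comp_comul := TensorProduct.ext' fun u v => (comul_star u v).symm

/-- The pairing of the tensor squares, as a morphism to a convolution algebra. -/
def pairingTensorHom (d : ℕ) :
    BCK d ⊗[ℝ] BCK d →ₐ[ℝ] WithConv (BCKDual d ⊗[ℝ] BCKDual d →ₗ[ℝ] ℝ) :=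
  Algebra.TensorProduct.algHomOfLinearMapTensorProduct
    ((WithConv.linearEquiv ℝ _).symm.toLinearMap ∘ₗ
      LinearMap.compRight ℝ (LinearMap.mul' ℝ ℝ) ∘ₗ
      TensorProduct.homTensorHomMap (.id ℝ) (BCKDual d) (BCKDual d) ℝ ℝ ∘ₗ
      TensorProduct.map (pairing d).flip (pairing d).flip)
    (fun x x' y y' => by
      -- A product of two pairings is a tensor product of linear forms followed by the
      -- multiplication of `ℝ`, an algebra morphism as `ℝ` is commutative.
      change convMap (Algebra.TensorProduct.lmul' ℝ) (WithConv.toConv (TensorProduct.map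
          (pairingHom d (x * x')).ofConv (pairingHom d (y * y')).ofConv)) =
        convMap (Algebra.TensorProduct.lmul' ℝ) (WithConv.toConv (TensorProduct.map
          (pairingHom d x).ofConv (pairingHom d y).ofConv)) *
        convMap (Algebra.TensorProduct.lmul' ℝ) (WithConv.toConv (TensorProduct.map
          (pairingHom d x').ofConv (pairingHom d y').ofConv))
      rw [← map_mul, TensorProduct.map_convMul_map, map_mul, map_mul])
    (WithConv.ext (TensorProduct.ext' fun u v => by
      change pairing d u 1 * pairing d v 1 = Coalgebra.counit v * Coalgebra.counit u
      rw [pairing_one, pairing_one, mul_comm]))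

theorem pairingTensorHom_tmul (x y : BCK d) (u v : BCKDual d) :
    pairingTensorHom d (x ⊗ₜ[ℝ] y) (u ⊗ₜ[ℝ] v) = pairing d u x * pairing d v y := rfl

theorem pairingTensorHom_apply (w : BCK d ⊗[ℝ] BCK d) (u v : BCKDual d) :
    pairingTensorHom d w (u ⊗ₜ[ℝ] v) =
      LinearMap.mul' ℝ ℝ (TensorProduct.map (pairing d u) (pairing d v) w) := by
  induction w with
  | zero => simp
  | add p q hp hq => simp only [map_add, WithConv.ofConv_add, LinearMap.add_apply, hp, hq]
  | tmul p q => rw [pairingTensorHom_tmul, TensorProduct.map_tmul, LinearMap.mul'_apply]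

theorem convComap_starCoalgHom_pairingHom (x : BCK d) (u v : BCKDual d) :
    convComap (starCoalgHom d) (pairingHom d x) (u ⊗ₜ[ℝ] v) = pairing d (star d u v) x := rfl

/-- The product `⋆` is dual to the Butcher-Connes-Kreimer coproduct. -/
theorem pairing_star (u v : BCKDual d) (x : BCK d) :
    pairing d (star d u v) x = LinearMap.mul' ℝ ℝ
      (TensorProduct.map (pairing d u) (pairing d v) (Coalgebra.comul x)) := by
  have : (convComap (starCoalgHom d)).comp (pairingHom d) =
      (pairingTensorHom d).comp (BCK.comulHom d) := by
    refine BCK.algHom_ext_bPlus fun a x hx => WithConv.ext (TensorProduct.ext' fun u v => ?_)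
    -- Transposing `B_+^a` in the second factor removes a root from `v`, so the hypothesis on `x` is
    -- used at `u ⊗ bMinus a v`. The remaining term `B_+^a x ⊗ 1` gives `ε(v) ⟨bMinus a u, x⟩`, and
    -- the sum is `bMinus_star`.
    have hx' := LinearMap.congr_fun (congrArg WithConv.ofConv hx) (u ⊗ₜ[ℝ] bMinus a v)
    rw [AlgHom.comp_apply, AlgHom.comp_apply, convComap_starCoalgHom_pairingHom] at hx' ⊢
    have h : ∀ w : BCK d ⊗[ℝ] BCK d,
        pairingTensorHom d ((BCK.bPlus a).lTensor (BCK d) w) (u ⊗ₜ[ℝ] v) =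
          pairingTensorHom d w (u ⊗ₜ[ℝ] bMinus a v) := by
      intro w
      induction w with
      | zero => simp
      | add p q hp hq => simp only [map_add, WithConv.ofConv_add, LinearMap.add_apply, hp, hq]
      | tmul p q =>
        rw [LinearMap.lTensor_tmul, pairingTensorHom_tmul, pairingTensorHom_tmul, pairing_bPlus]
    rw [BCK.comulHom_bPlus, map_add, WithConv.ofConv_add, LinearMap.add_apply, h,
      pairingTensorHom_tmul, pairing_one, pairing_bPlus, pairing_bPlus, bMinus_star, map_add,
      LinearMap.add_apply, hx', map_smul, LinearMap.smul_apply, smul_eq_mul, mul_comm]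
  have hx := LinearMap.congr_fun (congrArg WithConv.ofConv (DFunLike.congr_fun this x)) (u ⊗ₜ[ℝ] v)
  rw [AlgHom.comp_apply, AlgHom.comp_apply, convComap_starCoalgHom_pairingHom,
    pairingTensorHom_apply] at hx
  exact hx

end BCKDual

/-! ### Iterated directional derivatives -/

section Directional

variable {m : ℕ} {V W : Type*} [NormedAddCommGroup V] [NormedSpace ℝ V]
  [NormedAddCommGroup W] [NormedSpace ℝ W]

/-- The derivative in the direction of a constant vector. -/
def dirDeriv (w : Fin m → ℝ) (φ : (Fin m → ℝ) → V) (y : Fin m → ℝ) : V := fderiv ℝ φ y w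

theorem ContDiff.dirDeriv {φ : (Fin m → ℝ) → V} (hφ : ContDiff ℝ ∞ φ) (w : Fin m → ℝ) :
    ContDiff ℝ ∞ (dirDeriv w φ) :=
  (hφ.fderiv_right (by simp)).clm_apply contDiff_const

theorem differentiableAt_of_smooth {φ : (Fin m → ℝ) → V} (hφ : ContDiff ℝ ∞ φ) (y : Fin m → ℝ) :
    DifferentiableAt ℝ φ y := hφ.differentiable (by simp) y

theorem dirDeriv_comm {φ : (Fin m → ℝ) → V} (hφ : ContDiff ℝ ∞ φ) (v w : Fin m → ℝ) :
    dirDeriv v (dirDeriv w φ) = dirDeriv w (dirDeriv v φ) := by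
  have h : ∀ v w y, dirDeriv v (dirDeriv w φ) y = fderiv ℝ (fderiv ℝ φ) y v w := by
    intro v w y
    have h1 : DifferentiableAt ℝ (fderiv ℝ φ) y :=
      (hφ.fderiv_right (m := ∞) (by simp)).differentiable (by simp) y
    have := fderiv_clm_apply h1 (differentiableAt_const (c := w))
    simp only [dirDeriv]
    change fderiv ℝ (fun y => fderiv ℝ φ y w) y v = _
    rw [this]
    simp
  funext y
  rw [h, h]
  exact hφ.contDiffAt.isSymmSndFDerivAt
    (by simpa using WithTop.coe_le_coe.2 (le_top : (2 : ℕ∞) ≤ ⊤)) v w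

theorem dirDeriv_eq_sum (w : Fin m → ℝ) (φ : (Fin m → ℝ) → V) (y : Fin m → ℝ) :
    dirDeriv w φ y = ∑ b, w b • dirDeriv (Pi.single b 1) φ y := by
  simp only [dirDeriv]
  conv_lhs => rw [pi_eq_sum_univ' w]
  rw [map_sum]
  refine Finset.sum_congr rfl fun b _ => ?_
  rw [map_smul]

theorem dirDeriv_clm_comp (ℓ : V →L[ℝ] W) {φ : (Fin m → ℝ) → V} (hφ : ContDiff ℝ ∞ φ)
    (w : Fin m → ℝ) : dirDeriv w (ℓ ∘ φ) = ℓ ∘ dirDeriv w φ := by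
  funext y
  rw [dirDeriv, fderiv_comp y ℓ.differentiableAt (differentiableAt_of_smooth hφ y)]
  simp [dirDeriv]

theorem dirDeriv_sum {ι : Type*} [Fintype ι] {φ : ι → (Fin m → ℝ) → V}
    (hφ : ∀ i, ContDiff ℝ ∞ (φ i)) (w : Fin m → ℝ) :
    dirDeriv w (fun y => ∑ i, φ i y) = fun y => ∑ i, dirDeriv w (φ i) y := by
  funext y
  rw [dirDeriv, fderiv_fun_sum fun i _ => differentiableAt_of_smooth (hφ i) y]
  simp [dirDeriv]

theorem dirDeriv_mul {A : Type*} [NormedCommRing A] [NormedAlgebra ℝ A] {φ ψ : (Fin m → ℝ) → A}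
    (hφ : ContDiff ℝ ∞ φ) (hψ : ContDiff ℝ ∞ ψ) (w : Fin m → ℝ) :
    dirDeriv w (φ * ψ) = dirDeriv w φ * ψ + φ * dirDeriv w ψ := by
  funext y
  rw [dirDeriv, fderiv_mul (differentiableAt_of_smooth hφ y) (differentiableAt_of_smooth hψ y)]
  simp [dirDeriv, mul_comm, add_comm]

/-- The derivative in the directions of a list of constant vectors. -/
def iterDirDeriv (l : List (Fin m → ℝ)) (φ : (Fin m → ℝ) → V) : (Fin m → ℝ) → V :=
  l.foldr dirDeriv φ

theorem ContDiff.iterDirDeriv {φ : (Fin m → ℝ) → V} (hφ : ContDiff ℝ ∞ φ)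
    (l : List (Fin m → ℝ)) : ContDiff ℝ ∞ (iterDirDeriv l φ) := by
  induction l with
  | nil => exact hφ
  | cons w l ih => exact ContDiff.dirDeriv ih w

/-- Symmetry of second derivatives; it frees `multisetDeriv` from the ordering chosen by `toList`.
-/
theorem iterDirDeriv_perm {φ : (Fin m → ℝ) → V} (hφ : ContDiff ℝ ∞ φ)
    {l l' : List (Fin m → ℝ)} (h : l.Perm l') : iterDirDeriv l φ = iterDirDeriv l' φ := by
  induction h with
  | nil => rfl
  | cons w _ ih => exact congrArg (dirDeriv w) ih
  | swap v w l => exact dirDeriv_comm (ContDiff.iterDirDeriv hφ l) w v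
  | trans _ _ h1 h2 => exact h1.trans h2

theorem listDeriv_eq_iteratedFDeriv (φ : (Fin m → ℝ) → V) (l : List (Fin m → ℝ))
    (y : Fin m → ℝ) : listDeriv φ l y = iteratedFDeriv ℝ l.length φ y l.get := by
  have h : l.get = fun i => ∑ b, l.get i b • (Pi.single b 1 : Fin m → ℝ) := by
    funext i
    ext j
    simp [Finset.sum_apply, Pi.single_apply]
  conv_rhs => rw [h]
  have h1 := (iteratedFDeriv ℝ l.length φ y).toMultilinearMap.map_sum
    fun i b => l.get i b • (Pi.single b 1 : Fin m → ℝ)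
  refine Eq.trans ?_ h1.symm
  exact Finset.sum_congr rfl fun b _ => (MultilinearMap.map_smul_univ _ _ _).symm

theorem listDeriv_eq_iterDirDeriv {φ : (Fin m → ℝ) → V} (hφ : ContDiff ℝ ∞ φ)
    (l : List (Fin m → ℝ)) : listDeriv φ l = iterDirDeriv l φ := by
  induction l with
  | nil =>
    funext y
    rw [listDeriv_eq_iteratedFDeriv]
    exact iteratedFDeriv_zero_apply _
  | cons w l ih =>
    funext y
    have h1 : DifferentiableAt ℝ (iteratedFDeriv ℝ l.length φ) y :=
      hφ.differentiable_iteratedFDeriv (by exact_mod_cast ENat.natCast_lt_top _) y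
    rw [listDeriv_eq_iteratedFDeriv]
    refine (iteratedFDeriv_succ_apply_left (n := l.length) _).trans ?_
    refine (fderiv_continuousMultilinear_apply_const_apply h1 l.get w).symm.trans ?_
    change _ = dirDeriv w (iterDirDeriv l φ) y
    rw [← ih, dirDeriv, funext (listDeriv_eq_iteratedFDeriv φ l)]

theorem multisetDeriv_zero (φ : (Fin m → ℝ) → V) : multisetDeriv φ 0 = φ := by
  funext y
  rw [multisetDeriv, Multiset.toList_zero, listDeriv_eq_iteratedFDeriv]
  exact iteratedFDeriv_zero_apply _

theorem multisetDeriv_cons {φ : (Fin m → ℝ) → V} (hφ : ContDiff ℝ ∞ φ) (w : Fin m → ℝ)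
    (s : Multiset (Fin m → ℝ)) : multisetDeriv φ (w ::ₘ s) = dirDeriv w (multisetDeriv φ s) := by
  change listDeriv φ (w ::ₘ s).toList = dirDeriv w (listDeriv φ s.toList)
  rw [listDeriv_eq_iterDirDeriv hφ, listDeriv_eq_iterDirDeriv hφ]
  refine iterDirDeriv_perm hφ (l' := w :: s.toList) (Multiset.coe_eq_coe.1 ?_)
  rw [Multiset.coe_toList, ← Multiset.cons_coe, Multiset.coe_toList]

theorem multisetDeriv_cons_dirDeriv {φ : (Fin m → ℝ) → V} (hφ : ContDiff ℝ ∞ φ) (w : Fin m → ℝ)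
    (s : Multiset (Fin m → ℝ)) : multisetDeriv φ (w ::ₘ s) = multisetDeriv (dirDeriv w φ) s := by
  induction s using Multiset.induction_on generalizing φ with
  | empty => rw [multisetDeriv_cons hφ, multisetDeriv_zero, multisetDeriv_zero]
  | cons v s ih =>
    rw [Multiset.cons_swap, multisetDeriv_cons hφ, ih hφ,
      multisetDeriv_cons (ContDiff.dirDeriv hφ w)]

/-- The components of `w` stand outside all derivatives, so the formula remains usable when `w` is
later replaced by a vector depending on `y`. -/
theorem multisetDeriv_cons_eq_sum {φ : (Fin m → ℝ) → V} (hφ : ContDiff ℝ ∞ φ) (w : Fin m → ℝ)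
    (s : Multiset (Fin m → ℝ)) (y : Fin m → ℝ) :
    multisetDeriv φ (w ::ₘ s) y =
      ∑ b, w b • multisetDeriv (dirDeriv (Pi.single b 1) φ) s y := by
  rw [multisetDeriv_cons hφ, dirDeriv_eq_sum]
  simp only [← multisetDeriv_cons hφ, multisetDeriv_cons_dirDeriv hφ]

end Directional

/-! ### Elementary differentials -/

section ElementaryDifferentials

open BCKDual

variable {d m : ℕ} {V W : Type*} [NormedAddCommGroup V] [NormedSpace ℝ V]
  [NormedAddCommGroup W] [NormedSpace ℝ W] (f : Fin d → (Fin m → ℝ) → Fin m → ℝ)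

/-- The partial derivative `∂_b`. -/
def partialDeriv (b : Fin m) (φ : (Fin m → ℝ) → V) : (Fin m → ℝ) → V := dirDeriv (Pi.single b 1) φ

theorem ContDiff.partialDeriv {φ : (Fin m → ℝ) → V} (hφ : ContDiff ℝ ∞ φ) (b : Fin m) :
    ContDiff ℝ ∞ (partialDeriv b φ) := ContDiff.dirDeriv hφ _

theorem elemField_basis (φ : (Fin m → ℝ) → V) (s : Forest d) (y : Fin m → ℝ) :
    elemField f φ (basis d s) y = multisetDeriv φ (s.map fun t => elemDiffTree f t y) y := by
  rw [elemField, Module.Basis.constr_basis]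

theorem elemField_one (φ : (Fin m → ℝ) → V) : elemField f φ (1 : BCKDual d) = φ := by
  funext y
  rw [← BCKDual.basis_zero, elemField_basis, Multiset.map_zero, multisetDeriv_zero]

/-- The basic recursion: induction on forests proceeds by removing a tree while replacing `φ` by its
partial derivatives, which is why later inductions generalise over `φ`. -/
theorem elemField_tree_mul {φ : (Fin m → ℝ) → V} (hφ : ContDiff ℝ ∞ φ) (t : Tree d)
    (w : BCKDual d) (y : Fin m → ℝ) :
    elemField f φ (basis d {t} * w) y =
      ∑ b, elemDiffTree f t y b • elemField f (partialDeriv b φ) w y := by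
  have : LinearMap.proj y ∘ₗ elemField f φ ∘ₗ LinearMap.mulLeft ℝ (basis d {t}) =
      ∑ b, elemDiffTree f t y b • (LinearMap.proj y ∘ₗ elemField f (partialDeriv b φ)) := by
    refine (basis d).ext fun s => ?_
    simp only [LinearMap.comp_apply, LinearMap.mulLeft_apply, LinearMap.proj_apply,
      LinearMap.sum_apply, LinearMap.smul_apply]
    rw [← basis_cons, elemField_basis, Multiset.map_cons, multisetDeriv_cons_eq_sum hφ]
    exact Finset.sum_congr rfl fun b _ => by rw [elemField_basis]; rfl
  simpa using LinearMap.congr_fun this w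

theorem elemDiffTree_node (a : Fin d) (s : Forest d) :
    elemDiffTree f (Tree.node a s) = elemField f (f a) (basis d s) := by
  funext y
  rw [elemField_basis, elemDiffTree, Tree.fold_node, Multiset.map_map]
  rfl

theorem elemDiff_eq_treeLift : elemDiff f = treeLift (elemDiffTree f) := rfl

theorem elemDiff_bPlus (a : Fin d) (u : BCKDual d) :
    elemDiff f (BCKDual.bPlus a u) = elemField f (f a) u := by
  have : elemDiff f ∘ₗ BCKDual.bPlus a = elemField f (f a) := by
    refine (basis d).ext fun s => ?_
    rw [LinearMap.comp_apply, BCKDual.bPlus_basis, elemDiff_eq_treeLift, treeLift_basis_singleton,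
      elemDiffTree_node]
  exact LinearMap.congr_fun this u

theorem elemField_bPlus_mul {φ : (Fin m → ℝ) → V} (hφ : ContDiff ℝ ∞ φ) (a : Fin d)
    (u w : BCKDual d) (y : Fin m → ℝ) :
    elemField f φ (BCKDual.bPlus a u * w) y =
      ∑ b, elemDiff f (BCKDual.bPlus a u) y b • elemField f (partialDeriv b φ) w y := by
  have : LinearMap.proj y ∘ₗ elemField f φ ∘ₗ LinearMap.mulRight ℝ w ∘ₗ BCKDual.bPlus a =
      ∑ b, (LinearMap.proj b ∘ₗ LinearMap.proj y ∘ₗ elemDiff f ∘ₗ BCKDual.bPlus a).smulRight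
        (elemField f (partialDeriv b φ) w y) := by
    refine (basis d).ext fun s => ?_
    simp only [LinearMap.comp_apply, LinearMap.mulRight_apply, LinearMap.proj_apply,
      LinearMap.sum_apply, LinearMap.smulRight_apply, BCKDual.bPlus_basis]
    rw [elemField_tree_mul f hφ, elemDiff_eq_treeLift, treeLift_basis_singleton]
  simpa using LinearMap.congr_fun this u

theorem elemField_graftTree_mul {φ : (Fin m → ℝ) → V} (hφ : ContDiff ℝ ∞ φ) (t : Tree d)
    (u w : BCKDual d) (y : Fin m → ℝ) :
    elemField f φ (graftTree t u * w) y =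
      ∑ b, elemDiff f (graftTree t u) y b • elemField f (partialDeriv b φ) w y := by
  obtain ⟨a, s, rfl⟩ := t.exists_eq_node
  rw [graftTree_node]
  exact elemField_bPlus_mul f hφ a _ w y

/-- Applied below to coordinate projections, to continuous linear functionals and to homotheties. -/
theorem elemField_clm_comp (ℓ : V →L[ℝ] W) {φ : (Fin m → ℝ) → V} (hφ : ContDiff ℝ ∞ φ)
    (u : BCKDual d) : elemField f (ℓ ∘ φ) u = ℓ ∘ elemField f φ u := by
  have key : ∀ (s : Forest d) {φ : (Fin m → ℝ) → V}, ContDiff ℝ ∞ φ → ∀ y,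
      elemField f (ℓ ∘ φ) (basis d s) y = ℓ (elemField f φ (basis d s) y) := by
    intro s
    induction s using Multiset.induction_on with
    | empty => intro φ _ y; rw [BCKDual.basis_zero, elemField_one, elemField_one]; rfl
    | cons t s ih =>
      intro φ hφ y
      rw [basis_cons, elemField_tree_mul f (ℓ.contDiff.comp hφ), elemField_tree_mul f hφ, map_sum]
      refine Finset.sum_congr rfl fun b _ => ?_
      rw [map_smul, ← ih (ContDiff.partialDeriv hφ b), partialDeriv, partialDeriv,
        dirDeriv_clm_comp ℓ hφ]
  have : elemField f (ℓ ∘ φ) = ℓ.toLinearMap.compLeft (Fin m → ℝ) ∘ₗ elemField (d := d) f φ :=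
    (basis d).ext fun s => funext fun y => key s hφ y
  exact LinearMap.congr_fun this u

theorem elemField_sum {ι : Type*} [Fintype ι] {φ : ι → (Fin m → ℝ) → V}
    (hφ : ∀ i, ContDiff ℝ ∞ (φ i)) (u : BCKDual d) :
    elemField f (fun y => ∑ i, φ i y) u = fun y => ∑ i, elemField f (φ i) u y := by
  have key : ∀ (s : Forest d) {φ : ι → (Fin m → ℝ) → V}, (∀ i, ContDiff ℝ ∞ (φ i)) → ∀ y,
      elemField f (fun y => ∑ i, φ i y) (basis d s) y = ∑ i, elemField f (φ i) (basis d s) y := by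
    intro s
    induction s using Multiset.induction_on with
    | empty => intro φ _ y; simp only [BCKDual.basis_zero, elemField_one]
    | cons t s ih =>
      intro φ hφ y
      rw [basis_cons, elemField_tree_mul f (ContDiff.sum fun i _ => hφ i)]
      simp only [elemField_tree_mul f (hφ _)]
      rw [Finset.sum_comm]
      refine Finset.sum_congr rfl fun b _ => ?_
      rw [← Finset.smul_sum, ← ih fun i => ContDiff.partialDeriv (hφ i) b, partialDeriv,
        dirDeriv_sum hφ]
      rfl
  have : elemField f (fun y => ∑ i, φ i y) = ∑ i, elemField (d := d) f (φ i) := by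
    refine (basis d).ext fun s => funext fun y => ?_
    rw [key s hφ, LinearMap.sum_apply, Finset.sum_apply]
  rw [this]
  funext y
  rw [LinearMap.sum_apply, Finset.sum_apply]

theorem elemField_add {φ ψ : (Fin m → ℝ) → V} (hφ : ContDiff ℝ ∞ φ) (hψ : ContDiff ℝ ∞ ψ)
    (u : BCKDual d) : elemField f (φ + ψ) u = elemField f φ u + elemField f ψ u := by
  have := elemField_sum f (φ := ![φ, ψ]) (by intro i; fin_cases i <;> assumption) u
  simp only [Fin.sum_univ_two] at this
  exact this

/-! ### Smoothness -/

variable {f}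

theorem contDiff_elemField_basis {s : Forest d} (hs : ∀ t ∈ s, ContDiff ℝ ∞ (elemDiffTree f t))
    {φ : (Fin m → ℝ) → V} (hφ : ContDiff ℝ ∞ φ) : ContDiff ℝ ∞ (elemField f φ (basis d s)) := by
  induction s using Multiset.induction_on generalizing φ with
  | empty => rwa [BCKDual.basis_zero, elemField_one]
  | cons t s ih =>
    rw [basis_cons, funext (elemField_tree_mul f hφ t (basis d s))]
    exact ContDiff.sum fun b _ =>
      (contDiff_pi.1 (hs t (Multiset.mem_cons_self t s)) b).smul
        (ih (fun u hu => hs u (Multiset.mem_cons_of_mem hu)) (ContDiff.partialDeriv hφ b))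

theorem contDiff_elemDiffTree (hf : ∀ a, ContDiff ℝ ∞ (f a)) (t : Tree d) :
    ContDiff ℝ ∞ (elemDiffTree f t) := by
  induction t using Tree.induction with
  | h a s ih =>
    rw [elemDiffTree_node]
    exact contDiff_elemField_basis ih (hf a)

theorem BCKDual.induction_basis {p : BCKDual d → Prop} (zero : p 0)
    (add : ∀ u v, p u → p v → p (u + v)) (smul : ∀ (c : ℝ) s, p (c • basis d s)) (u : BCKDual d) :
    p u := by
  rw [← (basis d).linearCombination_repr u]
  induction (basis d).repr u using Finsupp.induction_linear with
  | zero => rwa [map_zero]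
  | add g h hg hh => rw [map_add]; exact add _ _ hg hh
  | single s c => rw [Finsupp.linearCombination_single]; exact smul c s

theorem contDiff_of_basis (T : BCKDual d →ₗ[ℝ] (Fin m → ℝ) → V)
    (h : ∀ s, ContDiff ℝ ∞ (T (basis d s))) (u : BCKDual d) : ContDiff ℝ ∞ (T u) := by
  induction u using BCKDual.induction_basis with
  | zero => rw [map_zero]; exact contDiff_const
  | add u v hu hv => rw [map_add]; exact hu.add hv
  | smul c s => rw [map_smul]; exact contDiff_const.smul (h s)

theorem contDiff_elemField (hf : ∀ a, ContDiff ℝ ∞ (f a)) {φ : (Fin m → ℝ) → V}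
    (hφ : ContDiff ℝ ∞ φ) (u : BCKDual d) : ContDiff ℝ ∞ (elemField f φ u) :=
  contDiff_of_basis _ (fun _ =>
    contDiff_elemField_basis (fun t _ => contDiff_elemDiffTree hf t) hφ) u

theorem contDiff_elemDiff (hf : ∀ a, ContDiff ℝ ∞ (f a)) (u : BCKDual d) :
    ContDiff ℝ ∞ (elemDiff f u) := by
  refine contDiff_of_basis _ (fun s => ?_) u
  rw [elemDiff_eq_treeLift, treeLift_basis]
  split_ifs with h
  · obtain ⟨t, rfl⟩ := Multiset.card_eq_one.1 h
    simpa using contDiff_elemDiffTree hf t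
  · exact contDiff_const

/-! ### The Leibniz rule and compositions -/

section Leibniz

variable {A : Type*} [NormedCommRing A] [NormedAlgebra ℝ A]

/-- The linear extension of `Υ_f[u ⊗ v]{φ ⊗ ψ} = Υ_f[u]{φ} Υ_f[v]{ψ}`. -/
def elemFieldTensor (f : Fin d → (Fin m → ℝ) → Fin m → ℝ) (φ ψ : (Fin m → ℝ) → A) :
    BCKDual d ⊗[ℝ] BCKDual d →ₗ[ℝ] (Fin m → ℝ) → A :=
  LinearMap.mul' ℝ ((Fin m → ℝ) → A) ∘ₗ TensorProduct.map (elemField f φ) (elemField f ψ)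

@[simp]
theorem elemFieldTensor_tmul (φ ψ : (Fin m → ℝ) → A) (u v : BCKDual d) :
    elemFieldTensor f φ ψ (u ⊗ₜ[ℝ] v) = elemField f φ u * elemField f ψ v := rfl

/-- The two summands of `t ⊗ 1 + 1 ⊗ t` correspond to the two terms of the product rule for `∂_b`.
-/
theorem elemFieldTensor_tree_mul {φ ψ : (Fin m → ℝ) → A} (hφ : ContDiff ℝ ∞ φ)
    (hψ : ContDiff ℝ ∞ ψ) (t : Tree d) (w : BCKDual d ⊗[ℝ] BCKDual d) (y : Fin m → ℝ) :
    elemFieldTensor f φ ψ ((basis d {t} ⊗ₜ[ℝ] 1 + 1 ⊗ₜ[ℝ] basis d {t}) * w) y =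
      ∑ b, elemDiffTree f t y b • (elemFieldTensor f (partialDeriv b φ) ψ w y +
        elemFieldTensor f φ (partialDeriv b ψ) w y) := by
  induction w with
  | zero => simp
  | add p q hp hq =>
    simp only [mul_add, map_add, Pi.add_apply, hp, hq, ← Finset.sum_add_distrib, ← smul_add]
    exact Finset.sum_congr rfl fun b _ => by abel_nf
  | tmul p q =>
    simp only [add_mul, map_add, Algebra.TensorProduct.tmul_mul_tmul, one_mul,
      elemFieldTensor_tmul, Pi.add_apply, Pi.mul_apply, elemField_tree_mul f hφ,
      elemField_tree_mul f hψ, smul_add, Finset.sum_add_distrib, Finset.sum_mul, Finset.mul_sum,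
      smul_mul_assoc, mul_smul_comm]

theorem elemField_mul (f : Fin d → (Fin m → ℝ) → Fin m → ℝ) {φ ψ : (Fin m → ℝ) → A}
    (hφ : ContDiff ℝ ∞ φ) (hψ : ContDiff ℝ ∞ ψ) (u : BCKDual d) :
    elemFieldTensor f φ ψ (Coalgebra.comul u) = elemField f (φ * ψ) u := by
  have key : ∀ (s : Forest d) {φ ψ : (Fin m → ℝ) → A}, ContDiff ℝ ∞ φ → ContDiff ℝ ∞ ψ → ∀ y,
      elemFieldTensor f φ ψ (Coalgebra.comul (basis d s)) y =
        elemField f (φ * ψ) (basis d s) y := by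
    intro s
    induction s using Multiset.induction_on with
    | empty =>
      intro φ ψ _ _ y
      rw [BCKDual.basis_zero, Bialgebra.comul_one, Algebra.TensorProduct.one_def,
        elemFieldTensor_tmul, elemField_one, elemField_one, elemField_one]
    | cons t s ih =>
      intro φ ψ hφ hψ y
      rw [basis_cons, comul_mul, comul_basis_singleton, elemFieldTensor_tree_mul hφ hψ,
        elemField_tree_mul f (φ := φ * ψ) (hφ.mul hψ)]
      refine Finset.sum_congr rfl fun b _ => ?_
      rw [ih (ContDiff.partialDeriv hφ b) hψ, ih hφ (ContDiff.partialDeriv hψ b),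
        partialDeriv, partialDeriv, partialDeriv, dirDeriv_mul hφ hψ,
        elemField_add f (φ := dirDeriv _ φ * ψ) (ψ := φ * dirDeriv _ ψ)
          ((ContDiff.dirDeriv hφ _).mul hψ) (hφ.mul (ContDiff.dirDeriv hψ _))]
      rfl
  have : elemFieldTensor f φ ψ ∘ₗ Coalgebra.comul = elemField f (φ * ψ) :=
    (basis d).ext fun s => funext fun y => key s hφ hψ y
  exact LinearMap.congr_fun this u

end Leibniz

/-- The trees of `u` attached to `t` are separated from the rest, which form `u'' ⋆ s`;
commutativity of convolution moves the factor of `t` to the front. -/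
theorem star_basis_cons (u : BCKDual d) (t : Tree d) (s : Forest d) :
    BCKDual.star d u (basis d (t ::ₘ s)) = LinearMap.mul' ℝ (BCKDual d)
      (TensorProduct.map (graftTree t).ofConv ((BCKDual.star d).flip (basis d s))
        (Coalgebra.comul u)) := by
  have h : (BCKDual.star d).flip (basis d s) =
      (WithConv.toConv LinearMap.id * graftHom d (basis d s)).ofConv :=
    LinearMap.ext fun u => star_eq_convMul u (basis d s)
  rw [star_eq_convMul, basis_cons, map_mul, mul_left_comm, graftHom_basis_singleton, h]
  rfl

theorem star_one (u : BCKDual d) : BCKDual.star d u 1 = u := by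
  rw [star_eq_convMul, map_one, mul_one]
  rfl

/-- Compositions with a forest, assuming the result for grafting onto its trees. -/
theorem elemField_star_basis (hf : ∀ a, ContDiff ℝ ∞ (f a)) {s : Forest d}
    (hs : ∀ t ∈ s, ∀ b u, elemField f (fun y => elemDiffTree f t y b) u =
      fun y => elemDiff f (graftTree t u) y b)
    {φ : (Fin m → ℝ) → ℝ} (hφ : ContDiff ℝ ∞ φ) (u : BCKDual d) :
    elemField f φ (BCKDual.star d u (basis d s)) = elemField f (elemField f φ (basis d s)) u := by
  induction s using Multiset.induction_on generalizing φ u with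
  | empty => rw [BCKDual.basis_zero, star_one, elemField_one]
  | cons t s ih =>
    have hs' := @ih fun r hr => hs r (Multiset.mem_cons_of_mem hr)
    have ht := hs t (Multiset.mem_cons_self t s)
    have hsm : ∀ b, ContDiff ℝ ∞ fun y => elemDiffTree f t y b :=
      fun b => contDiff_pi.1 (contDiff_elemDiffTree hf t) b
    have hsm' : ∀ b, ContDiff ℝ ∞ (elemField f (partialDeriv b φ) (basis d s)) :=
      fun b => contDiff_elemField hf (ContDiff.partialDeriv hφ b) _
    -- As a function of `y` this is a sum of products, to which the Leibniz rule `elemField_mul`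
    -- applies and splits `u` by its coproduct.
    have h1 : elemField f φ (basis d (t ::ₘ s)) = fun y => ∑ b,
        ((fun y => elemDiffTree f t y b) * elemField f (partialDeriv b φ) (basis d s)) y := by
      funext y
      rw [basis_cons, elemField_tree_mul f hφ]
      rfl
    rw [h1, elemField_sum f (φ := fun b => (fun y => elemDiffTree f t y b) *
      elemField f (partialDeriv b φ) (basis d s)) fun b => (hsm b).mul (hsm' b), star_basis_cons]
    simp only [← elemField_mul f (hsm _) (hsm' _)]
    funext y
    generalize (Coalgebra.comul u : BCKDual d ⊗[ℝ] BCKDual d) = w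
    induction w with
    | zero => simp
    | add p q hp hq => simp only [map_add, Pi.add_apply, hp, hq, Finset.sum_add_distrib]
    | tmul p q =>
      -- The part `p` of `u` acts on the coefficient `Υ^b[t]`, grafting onto `t`; the part `q` acts
      -- on `Υ[s]{∂_b φ}`, where the induction hypothesis applies.
      rw [TensorProduct.map_tmul, LinearMap.mul'_apply, elemField_graftTree_mul f hφ]
      refine Finset.sum_congr rfl fun b _ => ?_
      rw [elemFieldTensor_tmul, ht, ← hs' (ContDiff.partialDeriv hφ b)]
      rfl

/-- Since `Υ^b[node a s] = Υ[s]{f_a^b}`, the forest statement for the branches gives `Υ[u ⋆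
s]{f_a^b}`, which is `Υ^b` of `B_+^a (u ⋆ s)`. Tree induction thereby discharges the hypothesis of
`elemField_star_basis`. -/
theorem elemField_elemDiffTree (hf : ∀ a, ContDiff ℝ ∞ (f a)) (t : Tree d) (b : Fin m)
    (u : BCKDual d) : elemField f (fun y => elemDiffTree f t y b) u =
      fun y => elemDiff f (graftTree t u) y b := by
  induction t using Tree.induction generalizing b u with
  | h a s ih =>
    have hcomp := fun u => elemField_clm_comp f
      (ContinuousLinearMap.proj (R := ℝ) (φ := fun _ : Fin m => ℝ) b) (hf a) u
    have h1 : (fun y => elemDiffTree f (Tree.node a s) y b) =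
        elemField f (fun y => f a y b) (basis d s) := by
      rw [elemDiffTree_node]
      exact (hcomp (basis d s)).symm
    rw [h1, ← elemField_star_basis hf ih (contDiff_pi.1 (hf a) b), graftTree_node, elemDiff_bPlus]
    exact hcomp _

/-- Elementary vector fields turn the product `⋆` into composition. -/
theorem elemField_star (hf : ∀ a, ContDiff ℝ ∞ (f a)) {φ : (Fin m → ℝ) → V}
    (hφ : ContDiff ℝ ∞ φ) (u v : BCKDual d) :
    elemField f φ (BCKDual.star d u v) = elemField f (elemField f φ v) u := by
  have key : ∀ s : Forest d, elemField f φ (BCKDual.star d u (basis d s)) =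
      elemField f (elemField f φ (basis d s)) u := by
    intro s
    funext y
    -- Continuous functionals separate points, which reduces values in `V` to the real-valued case,
    -- where products are available.
    refine (SeparatingDual.eq_iff_forall_dual_eq (R := ℝ)).2 fun ℓ => ?_
    have h1 : ∀ w : BCKDual d, ℓ (elemField f φ w y) = elemField f (ℓ ∘ φ) w y := fun w =>
      (congrFun (elemField_clm_comp f ℓ hφ w) y).symm
    have h2 : ℓ (elemField f (elemField f φ (basis d s)) u y) =
        elemField f (ℓ ∘ elemField f φ (basis d s)) u y :=
      (congrFun (elemField_clm_comp f ℓ (contDiff_elemField hf hφ (basis d s)) u) y).symm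
    rw [h1, h2, ← elemField_clm_comp f ℓ hφ,
      elemField_star_basis hf (fun t _ => elemField_elemDiffTree hf t) (ℓ.contDiff.comp hφ)]
  -- On the right `v` enters through the function being differentiated, so linearity in `v` requires
  -- linearity of `elemField` in smooth functions.
  have hsmul : ∀ (c : ℝ) {χ : (Fin m → ℝ) → V}, ContDiff ℝ ∞ χ →
      elemField f (c • χ) u = c • elemField f χ u := fun c _ hχ =>
    elemField_clm_comp f (c • ContinuousLinearMap.id ℝ V) hχ u
  induction v using BCKDual.induction_basis with
  | zero => simpa using (hsmul 0 (contDiff_const (c := (0 : V)))).symm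
  | add v w hv hw =>
    rw [map_add, map_add, map_add, hv, hw,
      elemField_add f (contDiff_elemField hf hφ v) (contDiff_elemField hf hφ w)]
  | smul c s =>
    rw [map_smul, map_smul, map_smul, key, hsmul c (contDiff_elemField hf hφ (basis d s))]

end ElementaryDifferentials

/-! ### The dual morphism -/

section DualMorphism

open BCKDual

variable {d : ℕ}

theorem BCKDual.ext_pairingTensor {w w' : BCKDual d ⊗[ℝ] BCKDual d}
    (h : ∀ x y, pairingTensorHom d (x ⊗ₜ[ℝ] y) w = pairingTensorHom d (x ⊗ₜ[ℝ] y) w') :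
    w = w' := by
  let b := (basis d).tensorProduct (basis d)
  have key : ∀ s t, (pairingTensorHom d (BCK.basis d s ⊗ₜ[ℝ] BCK.basis d t)).ofConv =
      ((Forest.symmFactor s : ℝ) * Forest.symmFactor t) • b.coord (s, t) := by
    refine fun s t => TensorProduct.ext' fun u v => ?_
    rw [pairingTensorHom_tmul, pairing_basis_right, pairing_basis_right, LinearMap.smul_apply,
      Module.Basis.coord_apply, Module.Basis.tensorProduct_repr_tmul_apply, smul_eq_mul,
      smul_eq_mul]
    ring
  refine b.repr.injective (Finsupp.ext fun p => ?_)
  have := h (BCK.basis d p.1) (BCK.basis d p.2)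
  rw [key] at this
  refine mul_left_cancel₀ (mul_ne_zero ?_ ?_) this <;>
    exact Nat.cast_ne_zero.2 (Forest.symmFactor_ne_zero _)

variable {H : Type*} [CommRing H] [HopfAlgebra ℝ H] {𝒜 : ℕ → Submodule ℝ H}

theorem exists_dualMap {Λ : BCK d →ₗ[ℝ] H}
    (hΛ : ∀ s, Λ (BCK.basis d s) ∈ 𝒜 (Forest.size s)) :
    ∃ Λs : gradedDual 𝒜 →ₗ[ℝ] BCKDual d, ∀ u x, pairing d (Λs u) x = u.1 (Λ x) := by
  have h : ∀ u : gradedDual 𝒜, ∃ w : BCKDual d, ∀ x, pairing d w x = u.1 (Λ x) := by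
    rintro ⟨u, N, hN⟩
    -- The coefficients of `Λ^* u` are forced by the pairing; they vanish on forests of size at
    -- least `N`, where `Λ s` has degree at least `N`.
    have hfin : (Function.support fun s : Forest d =>
        u (Λ (BCK.basis d s)) / (Forest.symmFactor s : ℝ)).Finite := by
      refine (Forest.finite_size_lt d N).subset fun s hs => ?_
      by_contra hlt
      exact hs (by simp only [hN _ (not_lt.1 hlt) _ (hΛ s), zero_div])
    refine ⟨(basis d).repr.symm (Finsupp.ofSupportFinite _ hfin), fun x => ?_⟩
    have : pairing d ((basis d).repr.symm (Finsupp.ofSupportFinite _ hfin)) = u ∘ₗ Λ := by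
      refine (BCK.basis d).ext fun s => ?_
      rw [pairing_basis_right, LinearEquiv.apply_symm_apply]
      exact div_mul_cancel₀ _ (Nat.cast_ne_zero.2 (Forest.symmFactor_ne_zero s))
    exact LinearMap.congr_fun this x
  choose F hF using h
  refine ⟨⟨⟨F, fun u v => ext_pairing fun x => ?_⟩, fun c u => ext_pairing fun x => ?_⟩, hF⟩
  · rw [map_add, LinearMap.add_apply, hF, hF, hF]
    rfl
  · rw [map_smul, LinearMap.smul_apply, hF]
    change c • u.1 (Λ x) = c • pairing d (F u) x
    rw [hF]

variable [GradedAlgebra 𝒜] [IsGradedHopf 𝒜]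

/-- Each property is tested against the nondegenerate pairing, where it becomes the dual property of
`Λ`: coproduct for `⋆`, counit for the unit, product for the coproduct, unit for the counit. -/
theorem isDualMorphism_of_pairing {Λ : BCK d →ₐc[ℝ] H} {Λs : gradedDual 𝒜 →ₗ[ℝ] BCKDual d}
    (h : ∀ u x, pairing d (Λs u) x = u.1 (Λ x)) : IsDualMorphism 𝒜 Λs where
  map_star u v := ext_pairing fun x => by
    rw [h, pairing_star]
    change TensorProduct.dualDistrib ℝ H H (u.1 ⊗ₜ[ℝ] v.1) (Coalgebra.comul (Λ x)) = _
    rw [← CoalgHomClass.map_comp_comul_apply]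
    generalize (Coalgebra.comul x : BCK d ⊗[ℝ] BCK d) = w
    induction w with
    | zero => simp
    | add p q hp hq => simp only [map_add, hp, hq]
    | tmul p q => simp [h]
  map_one := ext_pairing fun x => by
    rw [h, one_pairing]
    exact CoalgHomClass.counit_comp_apply Λ x
  map_comul u := ext_pairingTensor fun x y => by
    have h1 : pairingTensorHom d (x ⊗ₜ[ℝ] y) (Coalgebra.comul (Λs u)) =
        pairing d (Λs u) (x * y) := (pairing_mul (Λs u) x y).symm
    have h2 : ∀ w : gradedDual 𝒜 ⊗[ℝ] gradedDual 𝒜,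
        pairingTensorHom d (x ⊗ₜ[ℝ] y) (TensorProduct.map Λs Λs w) =
          dualPair 𝒜 w (Λ x ⊗ₜ[ℝ] Λ y) := by
      intro w
      induction w with
      | zero => simp
      | add p q hp hq => simp only [map_add, LinearMap.add_apply, hp, hq]
      | tmul p q =>
        rw [TensorProduct.map_tmul, pairingTensorHom_tmul, h, h]
        rfl
    rw [h1, h2, h, map_mul, dualPair_dualComul]
  map_counit u := by rw [← pairing_one, h, map_one]

end DualMorphism

end FlowRDE

end

/-! ### The theorem -/

open FlowRDE in
theorem theorem1 {d : ℕ} {H : Type*} [CommRing H] [HopfAlgebra ℝ H]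
    (𝒜 : ℕ → Submodule ℝ H) [GradedAlgebra 𝒜] [IsGradedHopf 𝒜]
    (L : Fin d → H →ₗ[ℝ] H) (B : H →ₗ[ℝ] H →ₗ[ℝ] ℝ) (hL : FixedPointAssumption 𝒜 L B) :
    ∃ Λ : BCK d →ₐc[ℝ] H,
      (∀ a x, Λ (BCK.bPlus a x) = L a (Λ x)) ∧
      (∀ Λ' : BCK d →ₐc[ℝ] H, (∀ a x, Λ' (BCK.bPlus a x) = L a (Λ' x)) → Λ' = Λ) ∧
      ∃ Λs : gradedDual 𝒜 →ₗ[ℝ] BCKDual d,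
        (∀ u x, BCKDual.pairing d (Λs u) x = u.1 (Λ x)) ∧
        IsDualMorphism 𝒜 Λs ∧
        ∀ (m : ℕ) (f : Fin d → (Fin m → ℝ) → Fin m → ℝ), (∀ a, ContDiff ℝ ∞ (f a)) →
          (∀ u, ContDiff ℝ ∞ (barElemDiff Λs f u)) ∧
          (∀ (V : Type) [NormedAddCommGroup V] [NormedSpace ℝ V] (φ : (Fin m → ℝ) → V),
            ContDiff ℝ ∞ φ →
              (∀ u, ContDiff ℝ ∞ (barElemField Λs f φ u)) ∧
              ∀ u v, barElemField Λs f φ (dualStar u v) =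
                barElemField Λs f (barElemField Λs f φ v) u) ∧
          ∀ (A : Type) [NormedCommRing A] [NormedAlgebra ℝ A] (φ ψ : (Fin m → ℝ) → A),
            ContDiff ℝ ∞ φ → ContDiff ℝ ∞ ψ →
              ∀ u, barElemFieldTensor Λs f φ ψ (dualComul 𝒜 u) =
                barElemField Λs f (φ * ψ) u := by
  obtain ⟨Λ, hΛ⟩ := BCK.exists_bialgHom_bPlus hL.cocycle
  obtain ⟨Λs, hΛs⟩ := exists_dualMap (𝒜 := 𝒜) (Λ := (Λ : BCK d →ₐ[ℝ] H).toLinearMap) fun s =>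
    BCK.map_basis_mem 𝒜 hL.homogeneous (Λ := (Λ : BCK d →ₐ[ℝ] H)) hΛ s
  have hdual : IsDualMorphism 𝒜 Λs := isDualMorphism_of_pairing hΛs
  refine ⟨Λ, hΛ, fun Λ' h' => BCK.bialgHom_ext_bPlus hΛ h', Λs, hΛs, hdual,
    fun m f hf => ⟨fun u => contDiff_elemDiff hf _, ?_, ?_⟩⟩
  · intro V _ _ φ hφ
    refine ⟨fun u => contDiff_elemField hf hφ _, fun u v => ?_⟩
    change elemField f φ (Λs (dualStar u v)) = elemField f (elemField f φ (Λs v)) (Λs u)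
    rw [hdual.map_star, elemField_star hf hφ]
  · intro A _ _ φ ψ hφ hψ u
    -- The Leibniz rule for forests at `Λ^* u`, with `Δ (Λ^* u) = (Λ^* ⊗ Λ^*) Δ_μ u`.
    change _ = elemField f (φ * ψ) (Λs u)
    rw [← elemField_mul f hφ hψ, hdual.map_comul, elemFieldTensor, LinearMap.comp_apply,
      ← LinearMap.comp_apply (TensorProduct.map _ _), ← TensorProduct.map_comp]
    rfl
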